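/- A quandle is a set $Q$ with a binary operation $*$ such that $x*x=x$ for all $x$ and every left translation $L_a\colon x\mapsto a*x$ is an automorphism of $(Q,*)$. It is simple if $|Q|>1$ and every quandle homomorphism from $Q$ is injective or constant. Let $\mathrm{LMlt}(Q)=\langle L_x : x\in Q\rangle$ and $\mathrm{Dis}(Q)=\langle L_xL_y^{-1} : x,y\in Q\rangle$. Let $Q$ be a simple quandle with $\mathrm{Dis}(Q)\cong A_n$, $n\geq 5$. If $n\neq 6$, then $\mathrm{LMlt}(Q)$ is isomorphic to $A_n$ or $S_n$. If $n=6$, then $\mathrm{LMlt}(Q)$ is isomorphic to $A_6$, or to one of the extensions of $A_6$ by $\mathbb Z_2$ acting by outer automorphisms, that is, groups $G$ with a normal subgroup $K\cong A_6$ of index $2$ such that every element of $G\setminus K$ acts on $K$ by conjugation as an outer (non-inner) automorphism. Up to isomorphism there are exactly three such groups, and they are pairwise non-isomorphic: $S_6$, the projective general linear group $\mathrm{PGL}_2(9)$ (SmallGroup(720,764) in GAP), and the Mathieu group $M_{10}$ (SmallGroup(720,765) in GAP). Here $M_{10}$ is the group of all permutations of the projective line $\mathbb F_9\cup\{\infty\}$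 of the form $x\mapsto\frac{ax+b}{cx+d}$ with $ad-bc$ a nonzero square in $\mathbb F_9$, or $x\mapsto\frac{ax^3+b}{cx^3+d}$ with $ad-bc$ a non-square in $\mathbb F_9$. The groups $S_6$ and $\mathrm{PGL}_2(9)$ are semidirect products $A_6\rtimes\mathbb Z_2$ in which the generator of $\mathbb Z_2$ acts as an outer automorphism of $A_6$. -/

import Mathlib

open scoped Quandles MatrixGroups

/-- The left multiplication group of a quandle: the group generated by the left translations
`L_x : y ↦ x ◃ y`. (Left translations are automorphisms, so this subgroup of the symmetric group
on `Q` is the subgroup of the automorphism group of `Q` generated by them.) -/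
def LMlt (Q : Type*) [Quandle Q] : Subgroup (Equiv.Perm Q) :=
  Subgroup.closure (Set.range fun x : Q => Rack.act' x)

/-- The displacement group of a quandle: the group generated by all `L_x L_y⁻¹`. -/
def Dis (Q : Type*) [Quandle Q] : Subgroup (Equiv.Perm Q) :=
  Subgroup.closure {f | ∃ x y : Q, f = Rack.act' x * (Rack.act' y)⁻¹}

/-- A quandle is simple if it has more than one element and every quandle homomorphism from it
is injective or constant. (The image of a homomorphism is a quotient of `Q`, so nothing is gained
from target quandles in other universes.) -/
structure IsSimpleQuandle.{u} (Q : Type u) [Quandle Q] : Prop where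
  nontrivial : Nontrivial Q
  injective_or_constant : ∀ (R : Type u) [Quandle R] (f : Q →◃ R),
    Function.Injective f ∨ ∃ c : R, ∀ x : Q, f x = c

/-- An automorphism of a group is outer if it is not conjugation by an element of the group. -/
def IsOuterAut {G : Type*} [Group G] (φ : MulAut G) : Prop :=
  φ ∉ (MulAut.conj : G →* MulAut G).range

/-- `G` is an extension of `N` by the group of order two acting by outer automorphisms: `G` has a
normal subgroup `K ≅ N` of index two such that every element of `G` outside `K` acts on `K`, by
conjugation, as an outer automorphism. -/
def IsOuterExtensionByTwo (N G : Type*) [Group N] [Group G] : Prop :=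
  ∃ (K : Subgroup G) (_ : K.Normal), Nonempty (K ≃* N) ∧ K.index = 2 ∧
    ∀ g : G, g ∉ K → IsOuterAut (MulAut.conjNormal g : MulAut K)

/-- `G` is a semidirect product `N ⋊ ℤ/2` in which the generator of `ℤ/2` acts as an outer
automorphism of `N`. -/
def IsOuterSemidirectByTwo (N G : Type*) [Group N] [Group G] : Prop :=
  ∃ φ : Multiplicative (ZMod 2) →* MulAut N,
    IsOuterAut (φ (Multiplicative.ofAdd 1)) ∧ Nonempty (G ≃* N ⋊[φ] Multiplicative (ZMod 2))

/-- The field with nine elements. -/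
abbrev F9 : Type := GaloisField 3 2

/-- The projective general linear group `PGL(2, 9)`. -/
abbrev PGL29 : Type := GL (Fin 2) F9 ⧸ Subgroup.center (GL (Fin 2) F9)

noncomputable section

open scoped Classical in
/-- The permutation `x ↦ (a x + b) / (c x + d)` of the projective line `F9 ∪ {∞}`. -/
def moebius : GL (Fin 2) F9 →* Equiv.Perm (OnePoint F9) :=
  MulAction.toPermHom (GL (Fin 2) F9) (OnePoint F9)

/-- The Frobenius permutation `x ↦ x ^ 3` of the projective line, fixing `∞`. -/
def frob : Equiv.Perm (OnePoint F9) where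
  toFun := OnePoint.map (frobeniusEquiv F9 3)
  invFun := OnePoint.map (frobeniusEquiv F9 3).symm
  left_inv x := by
    induction x using OnePoint.rec with
    | infty => rfl
    | coe x => simp [OnePoint.map_some]
  right_inv x := by
    induction x using OnePoint.rec with
    | infty => rfl
    | coe x => simp [OnePoint.map_some]

theorem frob_frob : frob * frob = 1 := by
  have hc : Nat.card F9 = 9 := by
    have := GaloisField.card 3 2 (by norm_num)
    norm_num at this; exact this
  have : Fintype F9 := Fintype.ofFinite _
  ext x
  induction x using OnePoint.rec with
  | infty => rfl
  | coe x =>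
    have h : (x ^ 3) ^ 3 = x := by
      have := FiniteField.pow_card x
      rw [← Nat.card_eq_fintype_card, hc] at this
      rw [← pow_mul]; exact this
    simp [frob, OnePoint.map_some, frobenius_def, h]

open scoped Classical in
theorem frob_moebius (g : GL (Fin 2) F9) :
    frob * moebius g = moebius (g.map (frobenius F9 3)) * frob := by
  ext x
  have := OnePoint.map_smul (frobenius F9 3) g x
  simpa [frob, moebius] using this

theorem isSquare_mul_iff (a b : F9ˣ) : IsSquare (a * b) ↔ (IsSquare a ↔ IsSquare b) := by
  have : Fintype F9 := Fintype.ofFinite _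
  have h2 : ringChar F9 ≠ 2 := by
    rw [ringChar.eq F9 3]; norm_num
  simp only [FiniteField.unit_isSquare_iff h2, mul_pow]
  have key : ∀ c : F9ˣ, c ^ (Fintype.card F9 / 2) = 1 ∨ c ^ (Fintype.card F9 / 2) = -1 := by
    intro c
    have := FiniteField.pow_dichotomy h2 c.ne_zero
    simpa [Units.ext_iff] using this
  have hne : (-1 : F9ˣ) ≠ 1 := by
    intro h
    exact Ring.neg_one_ne_one_of_char_ne_two h2 (by simpa [Units.ext_iff] using h)
  rcases key a with ha | ha <;> rcases key b with hb | hb <;> simp [ha, hb, hne]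

theorem isSquare_det_frob (g : GL (Fin 2) F9) :
    IsSquare (g.map (frobenius F9 3)).det ↔ IsSquare g.det := by
  have h : (g.map (frobenius F9 3)).det = g.det * g.det * g.det := by
    ext
    simp [Matrix.det_fin_two, frobenius_def]
    rw [← frobenius_def, ← frobenius_def, ← frobenius_def, ← frobenius_def, ← map_mul, ← map_mul,
      ← map_sub, frobenius_def]
    ring
  rw [h, isSquare_mul_iff]
  simp

/-- The Mathieu group `M₁₀` in its action on the projective line over `F9`: all permutations
`x ↦ (a x + b) / (c x + d)` with `a d - b c` a nonzero square, and all permutations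
`x ↦ (a x ^ 3 + b) / (c x ^ 3 + d)` with `a d - b c` not a square. -/
def M10 : Subgroup (Equiv.Perm (OnePoint F9)) where
  carrier := {σ | ∃ g : GL (Fin 2) F9, (IsSquare g.det ∧ σ = moebius g) ∨
    (¬ IsSquare g.det ∧ σ = moebius g * frob)}
  one_mem' := ⟨1, Or.inl ⟨by simp, by simp⟩⟩
  mul_mem' := by
    rintro _ _ ⟨g, ⟨hg, rfl⟩ | ⟨hg, rfl⟩⟩ ⟨h, ⟨hh, rfl⟩ | ⟨hh, rfl⟩⟩
    · exact ⟨g * h, Or.inl ⟨by simp [isSquare_mul_iff, *], by simp⟩⟩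
    · exact ⟨g * h, Or.inr ⟨by simp [isSquare_mul_iff, *], by simp [mul_assoc]⟩⟩
    · exact ⟨g * h.map (frobenius F9 3),
        Or.inr ⟨by rw [map_mul, isSquare_mul_iff, isSquare_det_frob]; simp [*],
          by rw [mul_assoc, frob_moebius, map_mul, mul_assoc]⟩⟩
    · exact ⟨g * h.map (frobenius F9 3),
        Or.inl ⟨by rw [map_mul, isSquare_mul_iff, isSquare_det_frob]; simp [*],
          by rw [mul_assoc, ← mul_assoc frob, frob_moebius, mul_assoc, frob_frob, map_mul,
            mul_one]⟩⟩
  inv_mem' := by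
    rintro _ ⟨g, ⟨hg, rfl⟩ | ⟨hg, rfl⟩⟩
    · exact ⟨g⁻¹, Or.inl ⟨by simpa using hg, by simp⟩⟩
    · refine ⟨(g⁻¹).map (frobenius F9 3), Or.inr ⟨?_, ?_⟩⟩
      · rw [isSquare_det_frob]; simpa using hg
      · rw [← frob_moebius, mul_inv_rev, map_inv, inv_eq_of_mul_eq_one_left frob_frob]

end

/-! The orbits of a normal subgroup of `LMlt Q` form a quotient quandle, so in a simple quandle such
a subgroup is trivial or transitive. Apply this to the centralizer of `Dis Q` in `LMlt Q`.
Commutators of `LMlt Q` lie in `Dis Q`, which has trivial center, so this centralizer is abelian. If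
it were transitive, it would contain everything that commutes with it, in particular `Dis Q`, which
would then be abelian with trivial center. Hence the centralizer is trivial, and conjugation embeds
`LMlt Q` into Aut(Aₙ) with `Dis Q` going onto Inn(Aₙ).

For n ≠ 6, Aut(Aₙ) is Sₙ: comparing centralizer orders shows that automorphisms preserve
three-cycles, and an injective endomorphism preserving three-cycles is conjugation by a permutation
(`exists_conj_of_isThreeCycle`). The image of `LMlt Q` lies between Aₙ and Sₙ, and the index is two.

For n = 6, an automorphism not induced by S₆ exchanges three-cycles with products of two of them,
and any two such automorphisms differ by one induced by S₆. So Inn(A₆) has index at most 4 in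
Aut(A₆). On the other hand S₆, PGL(2,9) and M₁₀ are outer extensions of A₆, once A₆ is identified
with PSL(2,9). Each gives a coset of outer automorphisms, and equal cosets would give isomorphic
groups. The three groups are told apart by elements of order 8 and by involutions outside the
subgroup A₆, so with the trivial coset they account for all four. Thus every outer extension is one
of the three, and every automorphism has inner square. Modulo `Dis Q`, `LMlt Q` is generated by a
single translation, so its index over `Dis Q` is at most two. -/

section

open Equiv Equiv.Perm Subgroup

/-! ### Three-cycles and endomorphisms that preserve them -/

section ThreeCycles

variable {α : Type*} [Fintype α] [DecidableEq α]

theorem Equiv.Perm.IsThreeCycle.apply_apply_apply {g : Perm α} (hg : g.IsThreeCycle) (x : α) :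
    g (g (g x)) = x := by
  have h := pow_orderOf_eq_one g
  rw [hg.orderOf] at h
  exact congrArg (fun f : Perm α => f x) h

theorem Equiv.Perm.IsThreeCycle.support_eq {g : Perm α} (hg : g.IsThreeCycle) {x : α}
    (hx : g x ≠ x) : g.support = {x, g x, g (g x)} := by
  symm
  apply Finset.eq_of_subset_of_card_le
  · intro y hy
    simp only [Finset.mem_insert, Finset.mem_singleton] at hy
    rcases hy with rfl | rfl | rfl <;> simpa using hx
  · have h3 := hg.apply_apply_apply x
    rw [hg.card_support, Finset.card_eq_three.mpr ⟨x, g x, g (g x), hx.symm, ?_, ?_, rfl⟩]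
    · intro h
      rw [← h] at h3
      exact hx h3
    · intro h
      exact hx (g.injective h).symm

/-- Two three-cycles whose product is an involution agree on a point that they move. -/
theorem Equiv.Perm.IsThreeCycle.exists_common_arrow {s t : Perm α} (hs : s.IsThreeCycle)
    (ht : t.IsThreeCycle) (hst : s * t * (s * t) = 1) (hne : s * t ≠ 1) :
    ∃ a, s a ≠ a ∧ t a = s a := by
  by_contra! hcon
  have hts : ∀ x, s (t (s (t x))) = x := fun x => congrArg (fun f : Perm α => f x) hst
  have hst' : ∀ x, t (s (t (s x))) = x := fun x => by
    apply s.injective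
    exact hts (s x)
  -- If `t` fixed a point `a` moved by `s`, the involution relation would make `s a` a common arrow.
  -- So the supports agree and, lacking a common arrow, `t` is the inverse of `s`.
  have hmove : ∀ a, s a ≠ a → t a ≠ a := by
    intro a ha hta
    have h1 := hts a
    rw [hta] at h1
    have h2 : t (s a) = s (s a) := by
      apply s.injective
      rw [h1, hs.apply_apply_apply]
    exact hcon (s a) (by simpa using ha) h2
  have hsupp : s.support = t.support := by
    apply Finset.eq_of_subset_of_card_le
    · intro x hx
      rw [mem_support] at hx ⊢
      exact hmove x hx
    · rw [hs.card_support, ht.card_support]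
  apply hne
  have hinv : ∀ a, s a ≠ a → t a = s (s a) := by
    intro a ha
    have h1 : t a ∈ s.support := by
      rw [hsupp, mem_support]
      simpa using hmove a ha
    rw [hs.support_eq ha] at h1
    simp only [Finset.mem_insert, Finset.mem_singleton] at h1
    rcases h1 with h | h | h
    · exact absurd h (hmove a ha)
    · exact absurd h (hcon a ha)
    · exact h
  ext x
  rw [Perm.mul_apply, Perm.one_apply]
  by_cases hx : s x = x
  · have : x ∉ t.support := by rw [← hsupp]; simpa using hx
    rw [mem_support, not_not] at this
    rw [this, hx]
  · rw [hinv x hx, hs.apply_apply_apply]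

/-- Two consecutive arrows determine a three-cycle. -/
theorem Equiv.Perm.IsThreeCycle.eq_of_apply_eq {s t : Perm α} (hs : s.IsThreeCycle)
    (ht : t.IsThreeCycle) {a : α} (ha : s a ≠ a) (h1 : t a = s a) (h2 : t (s a) = s (s a)) :
    t = s := by
  have hsupp : s.support = t.support := by
    rw [hs.support_eq ha, ht.support_eq (h1 ▸ ha), h1, h2]
  ext x
  by_cases hx : s x = x
  · have : x ∉ t.support := by rw [← hsupp]; simpa using hx
    rw [mem_support, not_not] at this
    rw [this, hx]
  · rw [← Ne, ← mem_support, hs.support_eq ha] at hx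
    simp only [Finset.mem_insert, Finset.mem_singleton] at hx
    rcases hx with rfl | rfl | rfl
    · exact h1
    · exact h2
    · rw [hs.apply_apply_apply, ← h2, ← h1, ht.apply_apply_apply]

/-- Up to the transposition `(q p)`, every permutation is a product of three-cycles `(p q i)`. -/
theorem mem_or_swap_mul_mem_of_star {p q : α} (hpq : p ≠ q) (H : Subgroup (Perm α))
    (hH : ∀ i, i ≠ p → i ≠ q → swap p q * swap q i ∈ H) (σ : Perm α) :
    σ ∈ H ∨ swap q p * σ ∈ H := by
  have hstar0 : ∀ i, i ≠ q → swap p q * swap q i ∈ H := by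
    intro i hiq
    by_cases hip : i = p
    · subst hip
      rw [swap_comm q i, swap_mul_self]
      exact H.one_mem
    · exact hH i hip hiq
  -- Every permutation is a product of transpositions `(q i)`, and products of two of these lie in
  -- `H`; only the parity of the number of factors remains.
  have hstar : ∀ i j, i ≠ q → j ≠ q → swap q i * swap q j ∈ H := by
    intro i j hi hj
    have := H.mul_mem (H.inv_mem (hstar0 i hi)) (hstar0 j hj)
    simpa [mul_assoc] using this
  have key : ∀ i, i ≠ q → ∀ σ : Perm α, (σ ∈ H ∨ swap q p * σ ∈ H) →
      (swap q i * σ ∈ H ∨ swap q p * (swap q i * σ) ∈ H) := by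
    intro i hi σ h
    rcases h with h | h
    · right
      rw [← mul_assoc]
      exact H.mul_mem (hstar p i hpq hi) h
    · left
      have := H.mul_mem (hstar i p hi hpq) h
      rwa [mul_assoc, swap_mul_self_mul] at this
  induction σ using swap_induction_on with
  | one => exact Or.inl H.one_mem
  | swap_mul σ i j hij h =>
    by_cases hi : i = q
    · subst hi; exact key j hij.symm σ h
    by_cases hj : j = q
    · subst hj; rw [swap_comm]; exact key i hi σ h
    have hsw : swap i j = swap q i * swap q j * swap q i := by
      rw [swap_comm q j, swap_mul_swap_mul_swap hj hij.symm]
    rw [hsw, mul_assoc, mul_assoc]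
    exact key i hi _ (key j hj _ (key i hi _ h))

/-- The even permutations are generated by the three-cycles `(p q i)`. -/
theorem alternatingGroup_le_of_star {p q : α} (hpq : p ≠ q) (H : Subgroup (Perm α))
    (hH : ∀ i, i ≠ p → i ≠ q → swap p q * swap q i ∈ H) : alternatingGroup α ≤ H := by
  intro σ hσ
  rw [mem_alternatingGroup] at hσ
  rcases mem_or_swap_mul_mem_of_star hpq (H ⊓ alternatingGroup α) (fun i hp hq => ⟨hH i hp hq,
    mem_alternatingGroup.mpr (by rw [Perm.sign_mul, sign_swap hpq, sign_swap hq.symm]; rfl)⟩) σ with h | h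
  · exact h.1
  · have := mem_alternatingGroup.mp h.2
    rw [Perm.sign_mul, sign_swap hpq.symm, hσ] at this
    exact absurd this (by decide)

theorem swap_mul_swap_isThreeCycle {p q i : α} (hpq : p ≠ q) (hp : i ≠ p) (hq : i ≠ q) :
    (swap p q * swap q i).IsThreeCycle := by
  rw [swap_comm p q]
  exact isThreeCycle_swap_mul_swap_same hpq.symm hq.symm hp.symm

/-- An endomorphism of the alternating group that sends three-cycles to three-cycles and is
injective is conjugation by a permutation. -/
theorem exists_conj_of_isThreeCycle (h5 : 5 ≤ Fintype.card α)
    (φ : alternatingGroup α →* alternatingGroup α) (hinj : Function.Injective φ)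
    (hφ : ∀ g : alternatingGroup α, (g : Perm α).IsThreeCycle → (φ g : Perm α).IsThreeCycle) :
    ∃ σ : Perm α, ∀ g : alternatingGroup α, (φ g : Perm α) = σ * g * σ⁻¹ := by
  obtain ⟨p, q, hpq⟩ : ∃ p q : α, p ≠ q :=
    Fintype.exists_pair_of_one_lt_card (by omega)
  have hex : ∀ s : Finset α, s.card ≤ 4 → ∃ i, i ∉ s := by
    intro s hs
    by_contra! h
    have : s = Finset.univ := Finset.eq_univ_iff_forall.mpr h
    rw [this, Finset.card_univ] at hs
    omega
  obtain ⟨u, hu⟩ := hex {p, q} (Finset.card_le_two.trans (by norm_num))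
  obtain ⟨v, hv⟩ := hex {p, q, u} (Finset.card_le_three.trans (by norm_num))
  simp only [Finset.mem_insert, Finset.mem_singleton, not_or] at hu hv
  let J := {i : α // i ≠ p ∧ i ≠ q}
  -- `c i` is the cycle p → q → i → p. All of them share the arrow p → q, and the product of two
  -- distinct ones is an involution. The aim is that their images share an arrow a → b.
  let c : J → alternatingGroup α := fun i =>
    ⟨swap p q * swap q i, (swap_mul_swap_isThreeCycle hpq i.2.1 i.2.2).mem_alternatingGroup⟩
  have hc3 : ∀ i, (φ (c i) : Perm α).IsThreeCycle := fun i =>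
    hφ _ (swap_mul_swap_isThreeCycle hpq i.2.1 i.2.2)
  have hcinj : Function.Injective c := by
    intro i j h
    have h1 : (c i : Perm α) = c j := by rw [h]
    have h2 := congrArg (fun f : Perm α => f q) h1
    have h3 : ∀ i : J, (c i : Perm α) q = i := fun i => by
      change (swap p q) (swap q i q) = _
      rw [swap_apply_left, swap_apply_of_ne_of_ne i.2.1 i.2.2]
    simp only [h3] at h2
    exact Subtype.ext h2
  have hcc : ∀ i j : J, i ≠ j → (c i) * (c j) * (c i * c j) = 1 ∧ c i * c j ≠ 1 := by
    rintro ⟨i, hip, hiq⟩ ⟨j, hjp, hjq⟩ hij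
    have hij : i ≠ j := fun h => hij (Subtype.ext h)
    constructor
    · apply Subtype.ext
      ext x
      simp only [c, Subgroup.coe_mul, Perm.mul_apply, Subgroup.coe_one, Perm.one_apply]
      simp only [swap_apply_def]
      grind
    · intro h
      have := congrArg (fun f : alternatingGroup α => (f : Perm α) i) h
      simp only [c, Subgroup.coe_mul, Perm.mul_apply, Subgroup.coe_one, Perm.one_apply,
        swap_apply_def] at this
      grind
  have hcommon : ∀ i j : J, i ≠ j → ∃ a, (φ (c i) : Perm α) a ≠ a ∧
      (φ (c j) : Perm α) a = (φ (c i) : Perm α) a := by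
    intro i j hij
    apply (hc3 i).exists_common_arrow (hc3 j)
    · have := congrArg φ (hcc i j hij).1
      rw [map_mul, map_mul, map_one] at this
      exact congrArg Subtype.val this
    · intro h
      apply (hcc i j hij).2
      apply hinj
      rw [map_mul, map_one]
      exact Subtype.ext h
  let i₀ : J := ⟨u, hu⟩
  let j₀ : J := ⟨v, hv.1, hv.2.1⟩
  have hij₀ : i₀ ≠ j₀ := fun h => hv.2.2 (congrArg Subtype.val h).symm
  obtain ⟨a, ha, hb⟩ := hcommon i₀ j₀ hij₀
  obtain ⟨b, hbdef⟩ : ∃ b, b = (φ (c i₀) : Perm α) a := ⟨_, rfl⟩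
  rw [← hbdef] at ha hb
  have hfb_ne : ∀ i j : J, i ≠ j → (φ (c i) : Perm α) a = b → (φ (c j) : Perm α) a = b →
      (φ (c i) : Perm α) b ≠ (φ (c j) : Perm α) b := by
    intro i j hij hi hj hcon
    apply hij
    apply hcinj
    apply hinj
    apply Subtype.ext
    symm
    apply (hc3 i).eq_of_apply_eq (hc3 j) (a := a)
    · rw [hi]; exact ha
    · rw [hi, hj]
    · rw [hi]; exact hcon.symm
  have hthree : ∀ g : Perm α, g.IsThreeCycle → g a = b → g b ≠ a ∧ g b ≠ b ∧ g (g b) = a := by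
    intro g hg hga
    have h3 := hg.apply_apply_apply a
    rw [hga] at h3
    refine ⟨fun h => ?_, fun h => ?_, h3⟩
    · rw [h, hga] at h3; exact ha h3
    · rw [h, h] at h3; exact ha h3
  -- A three-cycle with arrows b → x and y → a, where y is neither b nor x, must be (b x y), which
  -- forces y → b instead.
  have hpath : ∀ t : Perm α, t.IsThreeCycle → ∀ x y, t b = x → t y = a → y ≠ b → y ≠ x →
      x ≠ b → y ≠ a → False := by
    intro t ht x y hx hy hyb hyx hxb hya
    have hs := ht.support_eq (x := b) (by rw [hx]; exact hxb)
    have hyin : y ∈ t.support := by rw [mem_support, hy]; exact hya.symm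
    rw [hs] at hyin
    simp only [Finset.mem_insert, Finset.mem_singleton, hx] at hyin
    rcases hyin with h | h | h
    · exact hyb h
    · exact hyx h
    · have h3 := ht.apply_apply_apply b
      rw [hx, ← h, hy] at h3
      exact ha h3.symm
  -- Two images (a b x) and (a b y) are known. A third one without the arrow a → b shares another
  -- arrow with each, b → x or x → a and b → y or y → a; all four combinations are impossible.
  have hall : ∀ i, (φ (c i) : Perm α) a = b := by
    intro i
    by_cases hi0 : i = i₀
    · rw [hi0, hbdef]
    by_cases hi1 : i = j₀
    · rw [hi1, hb]
    obtain ⟨hx1, hx2, hx3⟩ := hthree _ (hc3 i₀) hbdef.symm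
    obtain ⟨hy1, hy2, hy3⟩ := hthree _ (hc3 j₀) hb
    have hxy := hfb_ne i₀ j₀ hij₀ hbdef.symm hb
    have harrow : ∀ k : J, k ≠ i → (φ (c k) : Perm α) a = b → (φ (c i) : Perm α) a ≠ b →
        (φ (c i) : Perm α) b = (φ (c k) : Perm α) b ∨
          (φ (c i) : Perm α) ((φ (c k) : Perm α) b) = a := by
      intro k hki hkab hiab
      obtain ⟨e, he, he'⟩ := hcommon k i hki
      have hs := (hc3 k).support_eq (x := a) (by rw [hkab]; exact ha)
      rw [← mem_support, hs, hkab] at he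
      simp only [Finset.mem_insert, Finset.mem_singleton] at he
      rcases he with rfl | rfl | rfl
      · exact absurd (he'.trans hkab) hiab
      · exact Or.inl he'
      · right
        rw [he', (hthree _ (hc3 k) hkab).2.2]
    by_contra hcon
    have h1 := harrow i₀ (Ne.symm hi0) hbdef.symm hcon
    have h2 := harrow j₀ (Ne.symm hi1) hb hcon
    rcases h1 with h1 | h1 <;> rcases h2 with h2 | h2
    · exact hxy (h1.symm.trans h2)
    · exact hpath _ (hc3 i) _ _ h1 h2 hy2 hxy.symm hx2 hy1
    · exact hpath _ (hc3 i) _ _ h2 h1 hx2 hxy hy2 hx1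
    · exact hxy ((φ (c i) : Perm α).injective (h1.trans h2.symm))
  -- The conjugating permutation is read off the images: p ↦ a, q ↦ b, and i goes to the third point
  -- of the image of `c i`.
  let f : α → α := fun i => if h : i ≠ p ∧ i ≠ q then (φ (c ⟨i, h⟩) : Perm α) b else
    if i = p then a else b
  have hfp : f p = a := by simp [f]
  have hfq : f q = b := by simp [f, hpq.symm]
  have hfJ : ∀ i : J, f i = (φ (c i) : Perm α) b := by
    intro i
    simp only [f, dif_pos i.2]
    rfl
  have hfinj : Function.Injective f := by
    have hJ : ∀ i : J, f i ≠ a ∧ f i ≠ b := by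
      intro i
      rw [hfJ]
      have := hthree _ (hc3 i) (hall i)
      exact ⟨this.1, this.2.1⟩
    have hcases : ∀ i, i = p ∨ i = q ∨ ∃ j : J, i = j := by
      intro i
      by_cases h1 : i = p
      · exact Or.inl h1
      by_cases h2 : i = q
      · exact Or.inr (Or.inl h2)
      exact Or.inr (Or.inr ⟨⟨i, h1, h2⟩, rfl⟩)
    intro i j hij
    rcases hcases i with rfl | rfl | ⟨i, rfl⟩ <;> rcases hcases j with rfl | rfl | ⟨j, rfl⟩
    · rfl
    · rw [hfp, hfq] at hij; exact absurd hij.symm ha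
    · rw [hfp] at hij; exact absurd hij.symm (hJ j).1
    · rw [hfp, hfq] at hij; exact absurd hij ha
    · rfl
    · rw [hfq] at hij; exact absurd hij.symm (hJ j).2
    · rw [hfp] at hij; exact absurd hij (hJ i).1
    · rw [hfq] at hij; exact absurd hij (hJ i).2
    · rw [hfJ, hfJ] at hij
      by_contra hne
      exact hfb_ne i j (fun h => hne (by rw [h])) (hall i) (hall j) hij
  let σ : Perm α := Equiv.ofBijective f (Finite.injective_iff_bijective.mp hfinj)
  have hσp : σ p = a := hfp
  have hσq : σ q = b := hfq
  have hσa : σ⁻¹ a = p := by rw [← hσp]; exact σ.symm_apply_apply p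
  have hσb : σ⁻¹ b = q := by rw [← hσq]; exact σ.symm_apply_apply q
  have hσJ : ∀ i : J, σ i = (φ (c i) : Perm α) b := hfJ
  have hσc : ∀ i : J, (φ (c i) : Perm α) = σ * (c i : Perm α) * σ⁻¹ := by
    intro i
    have hcp : (c i : Perm α) p = q := by
      change (swap p q) (swap q i p) = _
      rw [swap_apply_of_ne_of_ne hpq i.2.1.symm, swap_apply_left]
    have hcq : (c i : Perm α) q = i := by
      change (swap p q) (swap q i q) = _
      rw [swap_apply_left, swap_apply_of_ne_of_ne i.2.1 i.2.2]
    symm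
    apply (hc3 i).eq_of_apply_eq (a := a)
    · rw [IsThreeCycle, cycleType_conj]
      exact swap_mul_swap_isThreeCycle hpq i.2.1 i.2.2
    · rw [hall i]; exact ha
    · rw [hall i, Perm.mul_apply, Perm.mul_apply, hσa, hcp, hσq]
    · rw [hall i, ← hσJ i, Perm.mul_apply, Perm.mul_apply, hσb, hcq]
  refine ⟨σ, ?_⟩
  let H : Subgroup (alternatingGroup α) := MonoidHom.eqLocus ((alternatingGroup α).subtype.comp φ)
    ((MulAut.conj σ).toMonoidHom.comp (alternatingGroup α).subtype)
  have hH : alternatingGroup α ≤ H.map (alternatingGroup α).subtype := by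
    apply alternatingGroup_le_of_star hpq
    intro i hp hq
    exact ⟨c ⟨i, hp, hq⟩, hσc _, rfl⟩
  intro g
  obtain ⟨g', hg', hgg⟩ := hH g.2
  have : g' = g := Subtype.ext hgg
  subst this
  exact hg'

end ThreeCycles

/-! ### Automorphisms of the alternating groups -/

section AutAlternating

variable {α : Type*} [Fintype α] [DecidableEq α]

open Nat in
theorem three_mul_factorial_gt {j : ℕ} : 2 * 3 ^ (j + 3) * (j + 3)! < (3 * j + 6)! * 3 := by
  induction j with
  | zero => decide
  | succ j ih =>
    have h1 : (3 * (j + 1) + 6)! = (3 * j + 9) * ((3 * j + 8) * ((3 * j + 7) * (3 * j + 6)!)) := by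
      rw [show 3 * (j + 1) + 6 = 3 * j + 6 + 1 + 1 + 1 by ring]
      simp only [Nat.factorial_succ]
    have h2 : 2 * 3 ^ (j + 1 + 3) * (j + 1 + 3)! =
        (3 * (j + 4)) * (2 * 3 ^ (j + 3) * (j + 3)!) := by
      rw [show j + 1 + 3 = (j + 3) + 1 by ring, Nat.factorial_succ, pow_succ]
      ring
    rw [h1, h2]
    calc (3 * (j + 4)) * (2 * 3 ^ (j + 3) * (j + 3)!)
        < (3 * (j + 4)) * ((3 * j + 6)! * 3) := by gcongr
      _ ≤ ((3 * j + 9) * (3 * j + 8) * (3 * j + 7)) * ((3 * j + 6)! * 3) := by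
          refine Nat.mul_le_mul_right _ ?_
          nlinarith [Nat.zero_le j, Nat.zero_le (j * j), Nat.zero_le (j * j * j)]
      _ = _ := by ring

-- The two sides compare centralizer orders of one three-cycle and of a product of `k` disjoint
-- ones; the factor 2 absorbs the passage from Sₙ to Aₙ. The case n = 6, k = 2 is a true exception.
open Nat in
theorem eq_one_of_factorial_le {n k : ℕ} (h6 : n ≠ 6) (hk : 1 ≤ k) (hkn : 3 * k ≤ n)
    (h : (n - 3)! * 3 ≤ 2 * ((n - 3 * k)! * 3 ^ k * k !)) : k = 1 := by
  obtain ⟨m, rfl⟩ := Nat.exists_eq_add_of_le hkn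
  by_contra hk1
  obtain ⟨k, rfl⟩ := Nat.exists_eq_add_of_le hk
  rcases k with _ | _ | j
  · omega
  · have h1 : 3 * (1 + (0 + 1)) + m - 3 = m + 1 + 1 + 1 := by omega
    have h2 : 3 * (1 + (0 + 1)) + m - 3 * (1 + (0 + 1)) = m := by omega
    rw [h1, h2] at h
    simp only [Nat.factorial_succ] at h
    have hm : 0 < m ! := Nat.factorial_pos m
    have h3 : m ! * (3 * ((m + 3) * (m + 2) * (m + 1))) ≤ m ! * 36 := by
      norm_num [Nat.factorial] at h
      nlinarith
    have h4 := Nat.le_of_mul_le_mul_left h3 hm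
    have : m ≠ 0 := by omega
    have : 1 ≤ m := by omega
    nlinarith [Nat.mul_le_mul this this, Nat.mul_le_mul (Nat.mul_le_mul this this) this]
  · have h1 : 3 * (1 + (j + 1 + 1)) + m - 3 = m + (3 * j + 6) := by omega
    have h2 : 3 * (1 + (j + 1 + 1)) + m - 3 * (1 + (j + 1 + 1)) = m := by omega
    rw [h1, h2, show 1 + (j + 1 + 1) = j + 3 by ring] at h
    have h3 := Nat.le_of_dvd (Nat.factorial_pos _)
      (Nat.factorial_mul_factorial_dvd_factorial_add m (3 * j + 6))
    have h4 := three_mul_factorial_gt (j := j)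
    have hm : 0 < m ! := Nat.factorial_pos m
    have h5 : m ! * ((3 * j + 6)! * 3) ≤ m ! * (2 * 3 ^ (j + 3) * (j + 3)!) := by
      nlinarith
    have := Nat.le_of_mul_le_mul_left h5 hm
    omega

theorem exists_cycleType_of_isThreeCycle (φ : MulAut (alternatingGroup α)) {g : alternatingGroup α}
    (hg : (g : Perm α).IsThreeCycle) :
    ∃ k, (φ g : Perm α).cycleType = Multiset.replicate (k + 1) 3 := by
  have h : orderOf (φ g : Perm α) = 3 := by
    rw [orderOf_coe, MulEquiv.orderOf_eq, ← orderOf_coe, hg.orderOf]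
  have := cycleType_prime_order (σ := (φ g : Perm α)) (by rw [h]; exact Nat.prime_three)
  rwa [h] at this

theorem card_centralizer_le_two_mul [Nontrivial α] (g : alternatingGroup α) :
    Nat.card (centralizer {(g : Perm α)}) ≤ 2 * Nat.card (centralizer {g}) := by
  set H := centralizer {(g : Perm α)}
  have h1 := ((alternatingGroup α).subgroupOf H).card_mul_index
  have h2 : ((alternatingGroup α).subgroupOf H).index ≤ 2 := by
    have := relIndex_dvd_index_of_normal (alternatingGroup α) H
    rw [alternatingGroup.index_eq_two] at this
    exact Nat.le_of_dvd two_pos this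
  have h3 : Nat.card ((alternatingGroup α).subgroupOf H) ≤ Nat.card (centralizer {g}) := by
    let f : (alternatingGroup α).subgroupOf H → centralizer {g} := fun x =>
      ⟨⟨x.1.1, x.2⟩, mem_centralizer_singleton_iff.mpr
        (Subtype.ext (mem_centralizer_singleton_iff.mp x.1.2))⟩
    refine Nat.card_le_card_of_injective f fun x y hxy => ?_
    exact Subtype.ext (Subtype.ext (congrArg (fun z => z.1.1) hxy))
  rw [← h1, mul_comm]
  exact Nat.mul_le_mul h2 h3

theorem card_centralizer_le (g : alternatingGroup α) :
    Nat.card (centralizer {g}) ≤ Nat.card (centralizer {(g : Perm α)}) := by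
  let f : centralizer {g} → centralizer {(g : Perm α)} := fun x =>
    ⟨x.1.1, mem_centralizer_singleton_iff.mpr
      (congrArg Subtype.val (mem_centralizer_singleton_iff.mp x.2))⟩
  refine Nat.card_le_card_of_injective f fun x y hxy => ?_
  exact Subtype.ext (Subtype.ext (congrArg (fun z => z.1) hxy))

theorem card_centralizer_mulAut {G : Type*} [Group G] (φ : MulAut G) (g : G) :
    Nat.card (centralizer {φ g}) = Nat.card (centralizer {g}) := by
  symm
  refine Nat.card_congr (φ.toEquiv.subtypeEquiv fun x => ?_)
  rw [mem_centralizer_singleton_iff, mem_centralizer_singleton_iff]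
  change _ ↔ φ x * φ g = φ g * φ x
  rw [← map_mul, ← map_mul, φ.injective.eq_iff]

theorem card_centralizer_of_cycleType {g : Perm α} {k : ℕ} (hk : k ≠ 0)
    (hg : g.cycleType = Multiset.replicate k 3) :
    Nat.card (centralizer {g}) =
      (Fintype.card α - 3 * k).factorial * 3 ^ k * k.factorial := by
  rw [nat_card_centralizer, hg]
  simp [Multiset.toFinset_replicate, hk, mul_comm k 3]

theorem three_mul_le_of_cycleType {g : Perm α} {k : ℕ}
    (hg : g.cycleType = Multiset.replicate k 3) : 3 * k ≤ Fintype.card α := by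
  have := sum_cycleType_le g
  rw [hg, Multiset.sum_replicate, smul_eq_mul] at this
  omega

/-- The image has order 3, hence is a product of disjoint three-cycles; equality of centralizer
orders leaves room for only one. -/
theorem isThreeCycle_mulAut_apply [Nontrivial α] (h6 : Fintype.card α ≠ 6)
    (φ : MulAut (alternatingGroup α)) {g : alternatingGroup α}
    (hg : (g : Perm α).IsThreeCycle) : (φ g : Perm α).IsThreeCycle := by
  obtain ⟨k, hk⟩ := exists_cycleType_of_isThreeCycle φ hg
  have h1 := card_centralizer_of_cycleType (k := 1) one_ne_zero hg.cycleType
  have h2 := card_centralizer_of_cycleType k.succ_ne_zero hk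
  have h3 := three_mul_le_of_cycleType hk
  have h4 : k + 1 = 1 := by
    apply eq_one_of_factorial_le h6 (by omega) h3
    have h5 := card_centralizer_le_two_mul g
    have h6 := card_centralizer_le (φ g)
    rw [card_centralizer_mulAut] at h6
    rw [h1] at h5
    rw [h2] at h6
    simp only [mul_one, pow_one, Nat.factorial_one] at h5
    exact h5.trans (Nat.mul_le_mul_left 2 h6)
  rw [IsThreeCycle, hk, h4]
  rfl

/-- From five points on, the three-cycles form one conjugacy class of the alternating group, so
testing a single one suffices. -/
theorem mem_range_conjNormal_of_isThreeCycle (h5 : 5 ≤ Fintype.card α)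
    (φ : MulAut (alternatingGroup α)) {g : alternatingGroup α}
    (hg : (g : Perm α).IsThreeCycle) (hφ : (φ g : Perm α).IsThreeCycle) :
    φ ∈ (MulAut.conjNormal : Perm α →* MulAut (alternatingGroup α)).range := by
  obtain ⟨σ, hσ⟩ := exists_conj_of_isThreeCycle h5 φ.toMonoidHom φ.injective (by
    intro h hh
    obtain ⟨c, hc⟩ := isConj_iff.mp
      (alternatingGroup.isThreeCycle_isConj (by rwa [Nat.card_eq_fintype_card]) hg hh)
    rw [← hc]
    change (φ (c * g * c⁻¹) : Perm α).IsThreeCycle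
    rw [map_mul, map_mul, map_inv, IsThreeCycle]
    simp only [Subgroup.coe_mul, Subgroup.coe_inv, cycleType_conj]
    exact hφ)
  refine ⟨σ, ?_⟩
  ext1 x
  apply Subtype.ext
  rw [MulAut.conjNormal_apply]
  exact (hσ x).symm

theorem exists_isThreeCycle (h3 : 3 ≤ Fintype.card α) :
    ∃ g : alternatingGroup α, (g : Perm α).IsThreeCycle := by
  obtain ⟨a, b, c, hab, hac, hbc⟩ := Fintype.two_lt_card_iff.mp h3
  have := isThreeCycle_swap_mul_swap_same hab hac hbc
  exact ⟨⟨_, this.mem_alternatingGroup⟩, this⟩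

theorem range_conjNormal_eq_top (h5 : 5 ≤ Fintype.card α) (h6 : Fintype.card α ≠ 6) :
    (MulAut.conjNormal : Perm α →* MulAut (alternatingGroup α)).range = ⊤ := by
  obtain ⟨g, hg⟩ := exists_isThreeCycle (α := α) (by omega)
  have : Nontrivial α := Fintype.one_lt_card_iff_nontrivial.mp (by omega)
  rw [eq_top_iff]
  intro φ _
  exact mem_range_conjNormal_of_isThreeCycle h5 φ hg (isThreeCycle_mulAut_apply h6 φ hg)

theorem index_range_conjNormal_le (h6 : Fintype.card α = 6) :
    (MulAut.conjNormal : Perm α →* MulAut (alternatingGroup α)).range.index = 1 ∨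
    (MulAut.conjNormal : Perm α →* MulAut (alternatingGroup α)).range.index = 2 := by
  set D := (MulAut.conjNormal : Perm α →* MulAut (alternatingGroup α)).range with hD
  obtain ⟨g, hg⟩ := exists_isThreeCycle (α := α) (by omega)
  have hct : ∀ φ, φ ∉ D → (φ g : Perm α).cycleType = {3, 3} := by
    intro φ hφ
    obtain ⟨k, hk⟩ := exists_cycleType_of_isThreeCycle φ hg
    have h3 := three_mul_le_of_cycleType hk
    have : k = 0 ∨ k = 1 := by omega
    rcases this with rfl | rfl
    · exact absurd (mem_range_conjNormal_of_isThreeCycle (by omega) φ hg hk) hφ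
    · exact hk
  have hmul : ∀ φ ψ, φ ∉ D → ψ ∉ D → φ⁻¹ * ψ ∈ D := by
    intro φ ψ hφ hψ
    have hφ' := hct φ hφ
    have hψ' := hct ψ hψ
    obtain ⟨τ, hτ⟩ : ∃ τ : alternatingGroup α, τ * φ g * τ⁻¹ = ψ g := by
      obtain ⟨τ, hτ⟩ := isConj_iff.mp (isConj_of_cycleType_eq (hφ'.trans hψ'.symm))
      by_cases hs : sign τ = 1
      · exact ⟨⟨τ, hs⟩, Subtype.ext hτ⟩
      -- A permutation of type {3, 3} commutes with an odd one, because a cycle length repeats; this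
      -- corrects the parity of `τ`.
      obtain ⟨ρ, hρ, hρs⟩ : ∃ ρ ∈ centralizer {(φ g : Perm α)}, ρ ∉ alternatingGroup α := by
        by_contra! hcon
        have := Equiv.Perm.count_le_one_of_centralizer_le_alternating (g := (φ g : Perm α))
          hcon 
        have := this 3
        rw [hφ'] at this
        simp at this
      have hs' : sign τ = -1 := (Int.units_eq_one_or _).resolve_left hs
      have hρs' : sign ρ = -1 :=
        (Int.units_eq_one_or _).resolve_left (fun h => hρs (mem_alternatingGroup.mpr h))
      refine ⟨⟨τ * ρ, mem_alternatingGroup.mpr (by rw [Perm.sign_mul, hs', hρs']; rfl)⟩,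
        Subtype.ext ?_⟩
      have hρ' := mem_centralizer_singleton_iff.mp hρ
      simp only [Subgroup.coe_mul, Subgroup.coe_inv]
      rw [← hτ, mul_inv_rev]
      rw [mul_assoc τ ρ, hρ']
      group
    apply mem_range_conjNormal_of_isThreeCycle (by omega) _ hg
    rw [MulAut.mul_apply, ← hτ, map_mul, map_mul, map_inv, MulAut.inv_apply_self, IsThreeCycle]
    simp only [Subgroup.coe_mul, Subgroup.coe_inv, cycleType_conj]
    exact hg
  by_cases htop : D = ⊤
  · left; rw [htop, index_top]
  right
  obtain ⟨a, ha⟩ : ∃ a, a ∉ D := by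
    by_contra! h
    exact htop (eq_top_iff.mpr fun x _ => h x)
  rw [index_eq_two_iff]
  refine ⟨a, fun b => ?_⟩
  by_cases hb : b ∈ D
  · exact Or.inr ⟨hb, fun h => ha ((D.mul_mem_cancel_left hb).mp h)⟩
  · refine Or.inl ⟨?_, hb⟩
    have := hmul b⁻¹ a (fun h => hb (by simpa using D.inv_mem h)) ha
    simpa using this

end AutAlternating

/-! ### PGL(2,9) and PSL(2,9) on the projective line -/

section ProjectiveLine

open scoped Classical in
theorem moebius_coe (g : GL (Fin 2) F9) (x : F9) : moebius g (x : OnePoint F9) =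
    if g 1 0 * x + g 1 1 = 0 then OnePoint.infty else
      (((g 0 0 * x + g 0 1) / (g 1 0 * x + g 1 1) : F9) : OnePoint F9) := by
  change g • (x : OnePoint F9) = _
  rw [OnePoint.smul_some_eq_ite]

open scoped Classical in
theorem moebius_infty (g : GL (Fin 2) F9) : moebius g OnePoint.infty =
    if g 1 0 = 0 then OnePoint.infty else ((g 0 0 / g 1 0 : F9) : OnePoint F9) := by
  change g • (OnePoint.infty : OnePoint F9) = _
  rw [OnePoint.smul_infty_eq_ite]

theorem card_F9 : Nat.card F9 = 9 := by
  have := GaloisField.card 3 2 (by norm_num)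
  norm_num at this
  exact this

theorem mem_center_of_moebius_fixes {g : GL (Fin 2) F9}
    (h1 : moebius g OnePoint.infty = OnePoint.infty)
    (h2 : moebius g ((0 : F9) : OnePoint F9) = ((0 : F9) : OnePoint F9))
    (h3 : moebius g ((1 : F9) : OnePoint F9) = ((1 : F9) : OnePoint F9)) :
    g ∈ Subgroup.center (GL (Fin 2) F9) := by
  rw [Matrix.GeneralLinearGroup.mem_center_iff_val_mem_range_scalar]
  rw [moebius_infty] at h1
  have hc : g 1 0 = 0 := by
    by_contra hc
    rw [if_neg hc] at h1
    exact OnePoint.coe_ne_infty _ h1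
  have hdet := g.det_ne_zero
  rw [Matrix.det_fin_two, hc, mul_zero, sub_zero] at hdet
  have ha := left_ne_zero_of_mul hdet
  have hd := right_ne_zero_of_mul hdet
  rw [moebius_coe, hc, zero_mul, zero_add, if_neg hd, OnePoint.coe_eq_coe, mul_zero, zero_add,
    div_eq_zero_iff, or_iff_left hd] at h2
  rw [moebius_coe, hc, zero_mul, zero_add, if_neg hd, OnePoint.coe_eq_coe, h2, mul_one, add_zero,
    div_eq_one_iff_eq hd] at h3
  refine ⟨g 0 0, ?_⟩
  ext i j
  fin_cases i <;> fin_cases j <;> simp [hc, h2, h3]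

theorem ker_moebius : moebius.ker = Subgroup.center (GL (Fin 2) F9) := by
  ext g
  rw [MonoidHom.mem_ker]
  constructor
  · intro h
    exact mem_center_of_moebius_fixes (by rw [h]; rfl) (by rw [h]; rfl) (by rw [h]; rfl)
  · rw [Matrix.GeneralLinearGroup.mem_center_iff_val_mem_range_scalar]
    rintro ⟨a, ha⟩
    have h00 : g 0 0 = a := by rw [← ha]; simp
    have h11 : g 1 1 = a := by rw [← ha]; simp
    have h10 : g 1 0 = 0 := by rw [← ha]; simp
    have h01 : g 0 1 = 0 := by rw [← ha]; simp
    have ha0 : a ≠ 0 := by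
      have hdet := g.det_ne_zero
      rw [Matrix.det_fin_two, h10, mul_zero, sub_zero, h00] at hdet
      exact left_ne_zero_of_mul hdet
    ext x
    induction x using OnePoint.rec with
    | infty => rw [moebius_infty, if_pos h10]; rfl
    | coe x =>
      rw [moebius_coe, h00, h01, h10, h11, zero_mul, zero_add, if_neg ha0, add_zero,
        mul_div_cancel_left₀ _ ha0]
      rfl

theorem exists_not_isSquare_units : ∃ u : F9ˣ, ¬ IsSquare u := by
  have : Fintype F9 := Fintype.ofFinite _
  have h2 : ringChar F9 ≠ 2 := by
    rw [ringChar.eq F9 3]; norm_num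
  obtain ⟨a, ha⟩ := FiniteField.exists_nonsquare h2
  have ha0 : a ≠ 0 := fun h => ha (h ▸ IsSquare.zero)
  refine ⟨Units.mk0 a ha0, fun ⟨b, hb⟩ => ha ⟨b, ?_⟩⟩
  exact congrArg Units.val hb

theorem exists_not_isSquare_det : ∃ g : GL (Fin 2) F9, ¬ IsSquare g.det := by
  obtain ⟨u, hu⟩ := exists_not_isSquare_units
  refine ⟨Matrix.GeneralLinearGroup.mkOfDetNeZero !![(u : F9), 0; 0, 1] (by simp), ?_⟩
  convert hu
  ext
  simp [Matrix.GeneralLinearGroup.mkOfDetNeZero]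

/-- The invertible matrices with square determinant. -/
def squareDet : Subgroup (GL (Fin 2) F9) where
  carrier := {g | IsSquare g.det}
  one_mem' := by simp
  mul_mem' {g h} hg hh := by
    simp only [Set.mem_ofPred_eq] at hg hh ⊢
    rw [map_mul, isSquare_mul_iff]
    simp [hg, hh]
  inv_mem' {g} hg := by
    simp only [Set.mem_ofPred_eq] at hg ⊢
    simpa using hg

theorem mem_squareDet {g : GL (Fin 2) F9} : g ∈ squareDet ↔ IsSquare g.det := Iff.rfl

theorem index_squareDet : squareDet.index = 2 := by
  obtain ⟨u, hu⟩ := exists_not_isSquare_det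
  rw [index_eq_two_iff]
  refine ⟨u, fun g => ?_⟩
  rw [mem_squareDet, mem_squareDet, map_mul, isSquare_mul_iff]
  by_cases h : IsSquare g.det <;> simp [h, hu]

theorem center_le_squareDet : Subgroup.center (GL (Fin 2) F9) ≤ squareDet := by
  intro g hg
  rw [Matrix.GeneralLinearGroup.center_eq_range_scalar] at hg
  obtain ⟨a, rfl⟩ := hg
  refine ⟨a, ?_⟩
  ext
  simp [pow_two]

/-- The group `PSL(2, 9)` as a group of permutations of the projective line. -/
noncomputable def PSL29 : Subgroup (Equiv.Perm (OnePoint F9)) := squareDet.map moebius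

/-- The subgroup `PSL(2, 9)` of `PGL(2, 9)`. -/
noncomputable def PSL29' : Subgroup PGL29 := squareDet.map (QuotientGroup.mk' _)

theorem index_PSL29' : PSL29'.index = 2 := by
  rw [PSL29', index_map_eq _ (QuotientGroup.mk'_surjective _), index_squareDet]
  rw [QuotientGroup.ker_mk']
  exact center_le_squareDet

/-- The action of `PGL(2, 9)` on the projective line. -/
noncomputable def PGL29.toPerm : PGL29 →* Equiv.Perm (OnePoint F9) :=
  QuotientGroup.lift _ moebius ker_moebius.ge

theorem PGL29.toPerm_mk (g : GL (Fin 2) F9) : PGL29.toPerm (QuotientGroup.mk' _ g) = moebius g :=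
  rfl

theorem PGL29.toPerm_injective : Function.Injective PGL29.toPerm := by
  rw [injective_iff_map_eq_one]
  intro x hx
  obtain ⟨g, rfl⟩ := QuotientGroup.mk'_surjective _ x
  rw [toPerm_mk, ← MonoidHom.mem_ker, ker_moebius] at hx
  rwa [QuotientGroup.mk'_apply, QuotientGroup.eq_one_iff]

theorem map_toPerm_PSL29' : PSL29'.map PGL29.toPerm = PSL29 := by
  rw [PSL29', Subgroup.map_map]
  rfl

theorem card_units_F9 : Nat.card F9ˣ = 8 := by
  rw [Nat.card_units, card_F9]

theorem card_center_GL : Nat.card (Subgroup.center (GL (Fin 2) F9)) = 8 := by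
  rw [Matrix.GeneralLinearGroup.center_eq_range_scalar, ← card_units_F9]
  refine (Nat.card_congr (MonoidHom.ofInjective (f := Matrix.GeneralLinearGroup.scalar (Fin 2))
    ?_).toEquiv).symm
  intro a b hab
  have := congrArg (fun g : GL (Fin 2) F9 => g 0 0) hab
  ext
  simpa using this

theorem card_PGL29 : Nat.card PGL29 = 720 := by
  have : Fintype F9 := Fintype.ofFinite _
  have h1 := Matrix.card_GL_field (𝔽 := F9) 2
  have h2 := Subgroup.card_eq_card_quotient_mul_card_subgroup (Subgroup.center (GL (Fin 2) F9))
  rw [h1, card_center_GL, Fin.prod_univ_two, ← Nat.card_eq_fintype_card, card_F9] at h2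
  change _ = Nat.card PGL29 * 8 at h2
  norm_num at h2
  omega

theorem card_PSL29 : Nat.card PSL29 = 360 := by
  have h := PSL29'.card_mul_index
  rw [card_PGL29, index_PSL29'] at h
  have h2 : Nat.card PSL29' = 360 := by omega
  rw [← h2, ← map_toPerm_PSL29']
  exact (Nat.card_congr (PSL29'.equivMapOfInjective _ PGL29.toPerm_injective).toEquiv).symm

/-- The translation x ↦ x + 1 fixes only ∞; conjugate it by an element carrying ∞ to `z`. -/
theorem exists_fixed_iff (z : OnePoint F9) : ∃ σ ∈ PSL29, ∀ w, σ w = w ↔ w = z := by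
  have hT : ∃ σ ∈ PSL29, ∀ w, σ w = w ↔ w = OnePoint.infty := by
    refine ⟨_, ⟨Matrix.GeneralLinearGroup.mkOfDetNeZero !![(1 : F9), 1; 0, 1] (by simp), ?_, rfl⟩, ?_⟩
    · refine ⟨1, ?_⟩
      ext
      simp [Matrix.GeneralLinearGroup.mkOfDetNeZero]
    · intro w
      induction w using OnePoint.rec with
      | infty => simp [moebius_infty, Matrix.GeneralLinearGroup.mkOfDetNeZero]
      | coe x => simp [moebius_coe, Matrix.GeneralLinearGroup.mkOfDetNeZero]
  obtain ⟨τ, hτ, hτw⟩ := hT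
  induction z using OnePoint.rec with
  | infty => exact ⟨τ, hτ, hτw⟩
  | coe x =>
    obtain ⟨ρ, hρ, hρx⟩ : ∃ ρ ∈ PSL29, ρ OnePoint.infty = (x : OnePoint F9) := by
      refine ⟨_, ⟨Matrix.GeneralLinearGroup.mkOfDetNeZero !![x, -1; 1, 0] (by simp), ?_, rfl⟩, ?_⟩
      · refine ⟨1, ?_⟩
        ext
        simp [Matrix.GeneralLinearGroup.mkOfDetNeZero]
      · simp [moebius_infty, Matrix.GeneralLinearGroup.mkOfDetNeZero]
    refine ⟨ρ * τ * ρ⁻¹, PSL29.mul_mem (PSL29.mul_mem hρ hτ) (PSL29.inv_mem hρ), fun w => ?_⟩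
    rw [Perm.mul_apply, Perm.mul_apply, ← hρx, ← Perm.eq_inv_iff_eq, hτw, Perm.inv_eq_iff_eq]

/-- A permutation commuting with `σ` preserves its fixed points, and every point is the only fixed
point of some `σ`. -/
theorem eq_one_of_commute_PSL29 (τ : Equiv.Perm (OnePoint F9))
    (h : ∀ σ ∈ PSL29, τ * σ = σ * τ) : τ = 1 := by
  ext z
  obtain ⟨σ, hσ, hw⟩ := exists_fixed_iff z
  have h1 := congrArg (fun f : Equiv.Perm (OnePoint F9) => f z) (h σ hσ)
  simp only [Perm.mul_apply] at h1
  rw [(hw z).mpr rfl] at h1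
  exact (hw _).mp h1.symm

end ProjectiveLine

/-! ### The exceptional isomorphism of A₆ with PSL(2,9) -/

section AlternatingSix

/-- A computable model `ZMod 3 [i]` of the field with nine elements. -/
abbrev GaussThree : Type := QuadraticAlgebra (ZMod 3) (-1) 0

/-- Since -1 is not a square modulo 3, the model is a field. -/
instance : Fact (∀ r : ZMod 3, r ^ 2 ≠ -1 + 0 * r) := ⟨by decide⟩

instance : Fintype GaussThree := Fintype.ofEquiv _ (QuadraticAlgebra.equivProd (-1 : ZMod 3) 0).symm

/-- An isomorphism between the model and the field with nine elements. -/
noncomputable def gaussEquiv : GaussThree ≃+* F9 :=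
  letI : Fintype F9 := Fintype.ofFinite _
  FiniteField.ringEquivOfCardEq (by
    rw [← Nat.card_eq_fintype_card (α := F9), card_F9]
    rfl)

/-- `sameSide z i j` says that `i` and `j` are in the same part of the partition of six points
into two parts of size three that corresponds to the point `z` of the projective line: the partition
`{0, 1, 2}, {3, 4, 5}` for `∞`, and that with `x` and `3 + y` exchanged for `x + y i`. -/
def sameSide (z : Option GaussThree) (i j : Fin 6) : Bool :=
  let inFirst (z : Option GaussThree) (i : Fin 6) : Bool :=
    match z with
    | none => i.val < 3
    | some w => if i.val < 3 then i.val ≠ w.re.val else i.val = 3 + w.im.val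
  inFirst z i == inFirst z j

/-- The relation `w = (a z + b) / (c z + d)` on the projective line. -/
def IsMoebius {K : Type*} [CommRing K] (a b c d : K) : Option K → Option K → Prop
  | none, none => c = 0
  | none, some w => a = w * c
  | some z, none => c * z + d = 0
  | some z, some w => c * z + d ≠ 0 ∧ a * z + b = w * (c * z + d)

instance {K : Type*} [CommRing K] [DecidableEq K] (a b c d : K) (z w : Option K) :
    Decidable (IsMoebius a b c d z w) := by
  cases z <;> cases w <;> simp only [IsMoebius] <;> infer_instance

theorem sameSide_injective : ∀ z w, (∀ i j, sameSide z i j = sameSide w i j) → z = w := by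
  decide +kernel

/-- Six points have ten partitions into two triples, as many as the projective line has points. This
and the next three statements match each generator (0 1 i) of A₆ with a Möbius map of determinant 1.
-/
theorem sameSide_moebius_two : ∀ z w : Option GaussThree, IsMoebius 1 1 0 1 z w →
    ∀ i j, sameSide w ((swap 0 1 * swap 1 2 : Perm (Fin 6)) i)
      ((swap 0 1 * swap 1 2 : Perm (Fin 6)) j) = sameSide z i j := by
  decide +kernel

theorem sameSide_moebius_three : ∀ z w : Option GaussThree, IsMoebius 0 1 2 1 z w →
    ∀ i j, sameSide w ((swap 0 1 * swap 1 3 : Perm (Fin 6)) i)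
      ((swap 0 1 * swap 1 3 : Perm (Fin 6)) j) = sameSide z i j := by
  decide +kernel

theorem sameSide_moebius_four : ∀ z w : Option GaussThree,
    IsMoebius ⟨0, 1⟩ ⟨0, 2⟩ 1 ⟨2, 2⟩ z w →
    ∀ i j, sameSide w ((swap 0 1 * swap 1 4 : Perm (Fin 6)) i)
      ((swap 0 1 * swap 1 4 : Perm (Fin 6)) j) = sameSide z i j := by
  decide +kernel

theorem sameSide_moebius_five : ∀ z w : Option GaussThree,
    IsMoebius ⟨0, 1⟩ ⟨0, 2⟩ 2 ⟨1, 2⟩ z w →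
    ∀ i j, sameSide w ((swap 0 1 * swap 1 5 : Perm (Fin 6)) i)
      ((swap 0 1 * swap 1 5 : Perm (Fin 6)) j) = sameSide z i j := by
  decide +kernel

/-- The projective line over `F9` in coordinates. -/
noncomputable def lineCoord : OnePoint F9 ≃ Option GaussThree :=
  Equiv.optionCongr gaussEquiv.symm.toEquiv

/-- The pairs of permutations of six points and of the projective line that respect the labelling
of points by partitions of the six points. -/
def compatiblePairs : Subgroup (Perm (Fin 6) × Perm (OnePoint F9)) where
  carrier := {p | ∀ z i j, sameSide (lineCoord (p.2 z)) (p.1 i) (p.1 j) =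
    sameSide (lineCoord z) i j}
  one_mem' := fun _ _ _ => rfl
  mul_mem' {p q} hp hq := fun z i j => (hp _ _ _).trans (hq _ _ _)
  inv_mem' {p} hp := fun z i j => by
    have := hp (p.2⁻¹ z) (p.1⁻¹ i) (p.1⁻¹ j)
    simpa using this.symm

theorem mem_compatiblePairs {p : Perm (Fin 6) × Perm (OnePoint F9)} : p ∈ compatiblePairs ↔
    ∀ z i j, sameSide (lineCoord (p.2 z)) (p.1 i) (p.1 j) = sameSide (lineCoord z) i j := Iff.rfl

/-- Distinct points carry distinct partitions. This uniqueness makes the choice of `τ` for each `σ`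
multiplicative. -/
theorem eq_of_mem_compatiblePairs {σ : Perm (Fin 6)} {τ τ' : Perm (OnePoint F9)}
    (h : (σ, τ) ∈ compatiblePairs) (h' : (σ, τ') ∈ compatiblePairs) : τ = τ' := by
  ext z
  apply lineCoord.injective
  apply sameSide_injective
  intro i j
  have h1 := h z (σ⁻¹ i) (σ⁻¹ j)
  have h2 := h' z (σ⁻¹ i) (σ⁻¹ j)
  rw [show σ (σ⁻¹ i) = i from σ.apply_symm_apply i,
    show σ (σ⁻¹ j) = j from σ.apply_symm_apply j] at h1 h2
  exact h1.trans h2.symm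

theorem exists_mem_PSL29 (a b c d : GaussThree) (hdet : a * d - b * c = 1) :
    ∃ τ ∈ PSL29, ∀ z, IsMoebius a b c d (lineCoord z) (lineCoord (τ z)) := by
  have hdet' : gaussEquiv a * gaussEquiv d - gaussEquiv b * gaussEquiv c = 1 := by
    rw [← map_mul, ← map_mul, ← map_sub, hdet, map_one]
  have hsome : ∀ x : F9, lineCoord (x : OnePoint F9) = some (gaussEquiv.symm x) := fun _ => rfl
  obtain ⟨g, hg, h00, h01, h10, h11⟩ : ∃ g : GL (Fin 2) F9, IsSquare g.det ∧
      g 0 0 = gaussEquiv a ∧ g 0 1 = gaussEquiv b ∧ g 1 0 = gaussEquiv c ∧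
      g 1 1 = gaussEquiv d := by
    refine ⟨Matrix.GeneralLinearGroup.mkOfDetNeZero
      !![gaussEquiv a, gaussEquiv b; gaussEquiv c, gaussEquiv d] ?_, ⟨1, ?_⟩, rfl, rfl, rfl, rfl⟩
    · rw [Matrix.det_fin_two_of, hdet']
      exact one_ne_zero
    · ext
      simp [Matrix.GeneralLinearGroup.mkOfDetNeZero, hdet']
  refine ⟨_, ⟨g, hg, rfl⟩, fun z => ?_⟩
  induction z using OnePoint.rec with
  | infty =>
    rw [moebius_infty, h10, h00]
    by_cases h : gaussEquiv c = 0
    · rw [if_pos h]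
      exact (map_eq_zero_iff _ gaussEquiv.injective).mp h
    · rw [if_neg h]
      change a = gaussEquiv.symm _ * c
      apply gaussEquiv.injective
      rw [map_mul, RingEquiv.apply_symm_apply, div_mul_cancel₀ _ h]
  | coe x =>
    obtain ⟨x, rfl⟩ := gaussEquiv.surjective x
    rw [moebius_coe, h00, h01, h10, h11, hsome, RingEquiv.symm_apply_apply, ← map_mul, ← map_mul,
      ← map_add, ← map_add]
    by_cases h : gaussEquiv (c * x + d) = 0
    · rw [if_pos h]
      exact (map_eq_zero_iff _ gaussEquiv.injective).mp h
    · rw [if_neg h]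
      change c * x + d ≠ 0 ∧ a * x + b = gaussEquiv.symm _ * (c * x + d)
      refine ⟨fun hcon => h (by rw [hcon, map_zero]), gaussEquiv.injective ?_⟩
      rw [map_mul gaussEquiv _ (c * x + d), RingEquiv.apply_symm_apply, div_mul_cancel₀ _ h]

theorem exists_compatible_PSL29 {σ : Perm (Fin 6)} (hσ : σ ∈ alternatingGroup (Fin 6)) :
    ∃ τ ∈ PSL29, (σ, τ) ∈ compatiblePairs := by
  have hle : alternatingGroup (Fin 6) ≤
      (compatiblePairs ⊓ (⊤ : Subgroup (Perm (Fin 6))).prod PSL29).map (MonoidHom.fst _ _) := by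
    have hmk : ∀ (a b c d : GaussThree) (σ : Perm (Fin 6)), a * d - b * c = 1 →
        (∀ z w, IsMoebius a b c d z w → ∀ i j, sameSide w (σ i) (σ j) = sameSide z i j) →
        σ ∈ (compatiblePairs ⊓ (⊤ : Subgroup (Perm (Fin 6))).prod PSL29).map
          (MonoidHom.fst _ _) := by
      intro a b c d σ hdet h
      obtain ⟨τ, hτ, hm⟩ := exists_mem_PSL29 a b c d hdet
      exact ⟨(σ, τ), ⟨fun z i j => h _ _ (hm z) i j, mem_prod.mpr ⟨mem_top _, hτ⟩⟩, rfl⟩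
    apply alternatingGroup_le_of_star (p := 0) (q := 1) (by decide)
    intro i h0 h1
    fin_cases i
    · exact absurd rfl h0
    · exact absurd rfl h1
    · exact hmk _ _ _ _ _ (by decide +kernel) sameSide_moebius_two
    · exact hmk _ _ _ _ _ (by decide +kernel) sameSide_moebius_three
    · exact hmk _ _ _ _ _ (by decide +kernel) sameSide_moebius_four
    · exact hmk _ _ _ _ _ (by decide +kernel) sameSide_moebius_five
  obtain ⟨⟨σ', τ⟩, ⟨h1, h2⟩, rfl⟩ := hle hσ
  exact ⟨τ, (mem_prod.mp h2).2, h1⟩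

instance isSimpleGroup_alternatingGroup_six : IsSimpleGroup (alternatingGroup (Fin 6)) :=
  alternatingGroup.isSimpleGroup (by simp)

/-- The exceptional homomorphism from `A₆` to `PSL(2, 9)`. -/
noncomputable def alternatingSixToPSL29 : alternatingGroup (Fin 6) →* PSL29 :=
  MonoidHom.mk' (fun σ => ⟨(exists_compatible_PSL29 σ.2).choose,
      (exists_compatible_PSL29 σ.2).choose_spec.1⟩) (by
    intro σ ρ
    apply Subtype.ext
    apply eq_of_mem_compatiblePairs (exists_compatible_PSL29 (σ * ρ).2).choose_spec.2
    exact compatiblePairs.mul_mem (exists_compatible_PSL29 σ.2).choose_spec.2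
      (exists_compatible_PSL29 ρ.2).choose_spec.2)

theorem alternatingSixToPSL29_compatible (σ : alternatingGroup (Fin 6)) :
    ((σ : Perm (Fin 6)), (alternatingSixToPSL29 σ : Perm (OnePoint F9))) ∈ compatiblePairs :=
  (exists_compatible_PSL29 σ.2).choose_spec.2

/-- A₆ is simple, and the cycle (0 1 3) does not preserve the partition at ∞, so the kernel is not
everything. -/
theorem alternatingSixToPSL29_injective : Function.Injective alternatingSixToPSL29 := by
  rw [← MonoidHom.ker_eq_bot_iff]
  refine (IsSimpleGroup.eq_bot_or_eq_top_of_normal _ inferInstance).resolve_right fun htop => ?_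
  let c : alternatingGroup (Fin 6) :=
    ⟨swap 0 1 * swap 1 3, mem_alternatingGroup.mpr (by decide)⟩
  have hc : alternatingSixToPSL29 c = 1 := by
    rw [← MonoidHom.mem_ker, htop]
    exact mem_top _
  have h := alternatingSixToPSL29_compatible c
  rw [hc] at h
  have h2 := h OnePoint.infty 0 1
  change sameSide none ((swap 0 1 * swap 1 3 : Perm (Fin 6)) 0)
    ((swap 0 1 * swap 1 3 : Perm (Fin 6)) 1) = sameSide none 0 1 at h2
  revert h2
  decide

/-- The exceptional isomorphism between `A₆` and `PSL(2, 9)`. -/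
noncomputable def alternatingSixEquivPSL29 : alternatingGroup (Fin 6) ≃* PSL29 :=
  MulEquiv.ofBijective alternatingSixToPSL29 (by
    have : Finite (OnePoint F9) := inferInstanceAs (Finite (Option F9))
    rw [Nat.bijective_iff_injective_and_card]
    refine ⟨alternatingSixToPSL29_injective, ?_⟩
    rw [card_PSL29, nat_card_alternatingGroup, Nat.card_eq_fintype_card, Fintype.card_fin]
    rfl)

end AlternatingSix

/-! ### Outer extensions as subgroups of the automorphism group -/

section OuterExtensions

universe u v w

/-- The group of inner automorphisms. -/
abbrev innerAut (N : Type u) [Group N] : Subgroup (MulAut N) := (MulAut.conj : N →* MulAut N).range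

variable {N : Type u} [Group N] {G : Type v} [Group G] {H : Type w} [Group H]

theorem mem_innerAut_congr {K : Type w} [Group K] (e : K ≃* N) (φ : MulAut K) :
    MulAut.congr e φ ∈ innerAut N ↔ φ ∈ innerAut K := by
  have hconj : ∀ k, MulAut.congr e (MulAut.conj k) = MulAut.conj (e k) := by
    intro k
    ext x
    simp [MulAut.congr]
  constructor
  · rintro ⟨n, hn⟩
    refine ⟨e.symm n, (MulAut.congr e).injective ?_⟩
    rw [hconj, e.apply_symm_apply, hn]
  · rintro ⟨k, rfl⟩
    exact ⟨e k, (hconj k).symm⟩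

/-- The group `G` is embedded by `θ` into `Aut N` as the union of the group of inner automorphisms
and of the coset of the outer automorphism `θ u`. -/
structure IsOuterEmbedding (θ : G →* MulAut N) (u : G) : Prop where
  injective : Function.Injective θ
  notMem : θ u ∉ innerAut N
  mem_range_iff : ∀ x, x ∈ θ.range ↔ x ∈ innerAut N ∨ (θ u)⁻¹ * x ∈ innerAut N
  mul_self_mem : ∀ g, θ g * θ g ∈ innerAut N

theorem conjNormal_coe_eq_conj (K : Subgroup G) [K.Normal] (k : K) :
    (MulAut.conjNormal (k : G) : MulAut K) = MulAut.conj k := by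
  ext x
  simp

/-- Conjugation on the normal subgroup is faithful: an element acting trivially acts as an inner
automorphism, so it lies in the subgroup, hence in its trivial center. -/
theorem IsOuterExtensionByTwo.exists_isOuterEmbedding (hN : Subgroup.center N = ⊥)
    (h : IsOuterExtensionByTwo N G) : ∃ (θ : G →* MulAut N) (u : G), IsOuterEmbedding θ u := by
  obtain ⟨K, hK, ⟨e⟩, hindex, hout⟩ := h
  let θ : G →* MulAut N := (MulAut.congr e).toMonoidHom.comp MulAut.conjNormal
  have hθ : ∀ g, θ g ∈ innerAut N ↔ g ∈ K := by
    intro g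
    change MulAut.congr e _ ∈ _ ↔ _
    rw [mem_innerAut_congr]
    constructor
    · intro hg
      by_contra hgK
      exact hout g hgK hg
    · intro hg
      exact ⟨⟨g, hg⟩, (conjNormal_coe_eq_conj K ⟨g, hg⟩).symm⟩
  have hinn : ∀ x ∈ innerAut N, ∃ g, θ g = x := by
    intro x hx
    obtain ⟨n, rfl⟩ := hx
    refine ⟨e.symm n, ?_⟩
    change MulAut.congr e (MulAut.conjNormal ((e.symm n : K) : G)) = _
    rw [conjNormal_coe_eq_conj]
    ext x
    simp [MulAut.congr]
  obtain ⟨u, hu⟩ := index_eq_two_iff'.mp hindex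
  have huK : u ∉ K := by
    rcases hu 1 with h | h
    · exact absurd K.one_mem h.2
    · simpa using h.2
  refine ⟨θ, u, ?_, fun h => huK ((hθ u).mp h), fun x => ⟨?_, ?_⟩, fun g => ?_⟩
  · rw [injective_iff_map_eq_one]
    intro g hg
    have hgK : g ∈ K := (hθ g).mp (hg ▸ one_mem _)
    have hg1 : (MulAut.conjNormal g : MulAut K) = 1 := (MulAut.congr e).injective (by
      rw [map_one]; exact hg)
    have hc : e ⟨g, hgK⟩ ∈ Subgroup.center N := by
      rw [Subgroup.mem_center_iff]
      intro n
      obtain ⟨k, rfl⟩ := e.surjective n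
      rw [← map_mul, ← map_mul]
      congr 1
      have := congrArg (fun f : MulAut K => (f k : G)) hg1
      simp only [MulAut.conjNormal_apply, MulAut.one_apply] at this
      apply Subtype.ext
      simp only [Subgroup.coe_mul]
      rw [mul_inv_eq_iff_eq_mul] at this
      exact this.symm
    rw [hN, Subgroup.mem_bot, map_eq_one_iff e e.injective] at hc
    exact congrArg Subtype.val hc
  · rintro ⟨g, rfl⟩
    by_cases hg : g ∈ K
    · exact Or.inl ((hθ g).mpr hg)
    · right
      rw [← map_inv, ← map_mul, hθ]
      have h1 := hu (u⁻¹ * g)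
      rw [mul_inv_cancel_left] at h1
      exact (h1.resolve_left fun h => hg h.1).1
  · rintro (hx | hx)
    · exact hinn x hx
    · obtain ⟨g, hg⟩ := hinn _ hx
      exact ⟨u * g, by rw [map_mul, hg, mul_inv_cancel_left]⟩
  · rw [← map_mul, hθ]
    exact mul_self_mem_of_index_two hindex g

/-- The image in Aut N depends only on the coset of `θ u`. -/
theorem IsOuterEmbedding.nonempty_mulEquiv {θ : G →* MulAut N} {u : G} {θ' : H →* MulAut N} {u' : H}
    (h : IsOuterEmbedding θ u) (h' : IsOuterEmbedding θ' u')
    (hu : (θ u)⁻¹ * θ' u' ∈ innerAut N) : Nonempty (G ≃* H) := by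
  have hr : θ.range = θ'.range := by
    ext x
    rw [h.mem_range_iff, h'.mem_range_iff]
    have : (θ u)⁻¹ * x = ((θ u)⁻¹ * θ' u') * ((θ' u')⁻¹ * x) := by group
    rw [this, (innerAut N).mul_mem_cancel_left hu]
  exact ⟨(MonoidHom.ofInjective h.injective).trans
    ((MulEquiv.subgroupCongr hr).trans (MonoidHom.ofInjective h'.injective).symm)⟩

/-- If `g` acted as some `k` in `K`, then `k⁻¹ * g` would centralize `K`, giving `g = k`. -/
theorem isOuterAut_conjNormal_of_centralizer {K : Subgroup G} [K.Normal]
    (hcent : ∀ g : G, (∀ k ∈ K, g * k = k * g) → g = 1) {g : G} (hg : g ∉ K) :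
    IsOuterAut (MulAut.conjNormal g : MulAut K) := by
  rintro ⟨k, hk⟩
  apply hg
  have h1 : (k : G)⁻¹ * g = 1 := by
    apply hcent
    intro x hx
    have := congrArg (fun f : MulAut K => (f ⟨x, hx⟩ : G)) hk
    simp only [MulAut.conjNormal_apply, MulAut.conj_apply, Subgroup.coe_mul, Subgroup.coe_inv]
      at this
    rw [eq_mul_inv_iff_mul_eq] at this
    rw [mul_assoc, ← this]
    group
  rw [← inv_mul_eq_one.mp h1]
  exact k.2

theorem isOuterExtensionByTwo_of_centralizer (K : Subgroup G) (e : K ≃* N) (hindex : K.index = 2)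
    (hcent : ∀ g : G, (∀ k ∈ K, g * k = k * g) → g = 1) : IsOuterExtensionByTwo N G :=
  have hK : K.Normal := normal_of_index_eq_two hindex
  ⟨K, hK, ⟨e⟩, hindex, fun _ hg => isOuterAut_conjNormal_of_centralizer hcent hg⟩

theorem IsOuterExtensionByTwo.of_mulEquiv (f : G ≃* H) (h : IsOuterExtensionByTwo N H) :
    IsOuterExtensionByTwo N G := by
  obtain ⟨K, hK, ⟨e⟩, hindex, hout⟩ := h
  let r : K.comap f.toMonoidHom ≃* K :=
    { toFun := fun x => ⟨f x.1, x.2⟩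
      invFun := fun x => ⟨f.symm x.1, by
        rw [mem_comap]
        change f (f.symm x.1) ∈ K
        rw [f.apply_symm_apply]
        exact x.2⟩
      left_inv := fun x => Subtype.ext (f.symm_apply_apply _)
      right_inv := fun x => Subtype.ext (f.apply_symm_apply _)
      map_mul' := fun x y => Subtype.ext (map_mul f _ _) }
  refine ⟨K.comap f.toMonoidHom, inferInstance, ⟨r.trans e⟩, ?_, fun g hg hin => ?_⟩
  · rw [index_comap_of_surjective _ f.surjective, hindex]
  · apply hout (f g) hg
    change _ ∈ innerAut K
    have hin' : (MulAut.conjNormal g : MulAut (K.comap f.toMonoidHom)) ∈ innerAut _ := hin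
    rw [← mem_innerAut_congr r] at hin'
    convert hin'
    ext x
    rw [MulAut.conjNormal_apply]
    change _ = f (g * f.symm x * g⁻¹)
    rw [map_mul, map_mul, map_inv, f.apply_symm_apply]

theorem isOuterSemidirectByTwo_of_involution (K : Subgroup G) [K.Normal] (e : K ≃* N)
    (hindex : K.index = 2) {t : G} (ht : t ∉ K) (htt : t * t = 1)
    (hout : IsOuterAut (MulAut.conjNormal t : MulAut K)) : IsOuterSemidirectByTwo N G := by
  have hZ : ∀ z : Multiplicative (ZMod 2), z = 1 ∨ z = Multiplicative.ofAdd 1 := by decide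
  have h1 : (Multiplicative.ofAdd 1 : Multiplicative (ZMod 2)) ≠ 1 := by decide
  have h2 : (Multiplicative.ofAdd 1 : Multiplicative (ZMod 2)) * Multiplicative.ofAdd 1 = 1 := by
    decide
  let s : Multiplicative (ZMod 2) →* G := MonoidHom.mk' (fun z => if z = 1 then 1 else t) (by
    intro a b
    rcases hZ a with rfl | rfl <;> rcases hZ b with rfl | rfl <;> simp [h1, h2, htt])
  have hs : s (Multiplicative.ofAdd 1) = t := by
    change (if (Multiplicative.ofAdd 1 : Multiplicative (ZMod 2)) = 1 then (1 : G) else t) = t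
    exact if_neg h1
  let φ : Multiplicative (ZMod 2) →* MulAut N :=
    ((MulAut.congr e).toMonoidHom.comp MulAut.conjNormal).comp s
  let i : N →* G := K.subtype.comp e.symm.toMonoidHom
  have hi : ∀ n, i n = (e.symm n : G) := fun _ => rfl
  let L : N ⋊[φ] Multiplicative (ZMod 2) →* G := SemidirectProduct.lift i s (by
    intro z
    ext n
    simp only [MonoidHom.comp_apply, MulEquiv.coe_toMonoidHom, MulAut.conj_apply, hi, φ]
    simp [MulAut.congr])
  have hL : ∀ x, L x = (e.symm x.left : G) * s x.right := fun _ => rfl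
  refine ⟨φ, ?_, ⟨(MulEquiv.ofBijective L ⟨?_, ?_⟩).symm⟩⟩
  · intro h
    apply hout
    change MulAut.congr e (MulAut.conjNormal (s _)) ∈ innerAut N at h
    rw [mem_innerAut_congr, hs] at h
    exact h
  · rw [injective_iff_map_eq_one]
    rintro ⟨n, z⟩ hx
    rw [hL] at hx
    rcases hZ z with rfl | rfl
    · rw [map_one, mul_one] at hx
      have hn : e.symm n = 1 := Subtype.ext hx
      rw [map_eq_one_iff e.symm e.symm.injective] at hn
      subst hn
      rfl
    · exfalso
      apply ht
      rw [hs] at hx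
      rw [← inv_eq_of_mul_eq_one_right hx]
      exact K.inv_mem (e.symm n).2
  · intro g
    by_cases hg : g ∈ K
    · refine ⟨⟨e ⟨g, hg⟩, 1⟩, ?_⟩
      rw [hL, e.symm_apply_apply, map_one, mul_one]
    · have hgt : g * t ∈ K := (mul_mem_iff_of_index_two hindex).mpr ⟨fun h => absurd h hg,
        fun h => absurd h ht⟩
      refine ⟨⟨e ⟨g * t, hgt⟩, Multiplicative.ofAdd 1⟩, ?_⟩
      rw [hL, e.symm_apply_apply, hs, mul_assoc, htt, mul_one]

theorem isOuterSemidirectByTwo_of_centralizer (K : Subgroup G) (e : K ≃* N)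
    (hindex : K.index = 2) (hcent : ∀ g : G, (∀ k ∈ K, g * k = k * g) → g = 1) {t : G}
    (ht : t ∉ K) (htt : t * t = 1) : IsOuterSemidirectByTwo N G :=
  have _ : K.Normal := normal_of_index_eq_two hindex
  isOuterSemidirectByTwo_of_involution K e hindex ht htt
    (isOuterAut_conjNormal_of_centralizer hcent ht)

/-- A subgroup of index two that is isomorphic to the alternating group on six points is mapped by
an isomorphism into any subgroup of index two. -/
theorem apply_mem_of_index_two {K : Subgroup G} (e : K ≃* alternatingGroup (Fin 6))
    {K' : Subgroup H} (hK' : K'.index = 2) (f : G ≃* H) {k : G} (hk : k ∈ K) : f k ∈ K' := by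
  let ψ : alternatingGroup (Fin 6) →* H :=
    f.toMonoidHom.comp (K.subtype.comp e.symm.toMonoidHom)
  -- Three-cycles generate A₆, each is a square because its order is odd, and squares lie in every
  -- subgroup of index two.
  have htop : K'.comap ψ = ⊤ := by
    rw [eq_top_iff, ← alternatingGroup.closure_isThreeCycles_eq_top, closure_le]
    intro c hc
    have h3 : c ^ 3 = 1 := by
      apply Subtype.ext
      have := pow_orderOf_eq_one (c : Perm (Fin 6))
      rwa [IsThreeCycle.orderOf hc] at this
    have h4 : c = c ^ 2 * c ^ 2 := by
      rw [← pow_add, show 2 + 2 = 3 + 1 from rfl, pow_add, h3, one_mul, pow_one]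
    rw [h4]
    change ψ (_ * _) ∈ K'
    rw [map_mul]
    exact mul_self_mem_of_index_two hK' _
  have := htop.ge (mem_top (e ⟨k, hk⟩))
  rw [mem_comap] at this
  simpa [ψ] using this

end OuterExtensions

/-! ### S₆, PGL(2,9) and M₁₀: outer extensions, pairwise distinct -/

section ThreeExtensions

/-- If `σ` moves `x`, some three-cycle fixes `x` but moves `σ x`, and cannot commute with `σ`. -/
theorem eq_one_of_commute_alternatingGroup {α : Type*} [Fintype α] [DecidableEq α]
    (h4 : 4 ≤ Fintype.card α) {σ : Perm α} (h : ∀ c ∈ alternatingGroup α, σ * c = c * σ) :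
    σ = 1 := by
  ext x
  rw [Perm.one_apply]
  by_contra hx
  obtain ⟨z, hz⟩ : ∃ z, z ∉ ({x, σ x} : Finset α) := by
    by_contra! hcon
    have := Finset.card_le_card (fun i _ => hcon i : Finset.univ ⊆ _)
    rw [Finset.card_univ] at this
    have := this.trans Finset.card_le_two
    omega
  obtain ⟨w, hw⟩ : ∃ w, w ∉ ({x, σ x, z} : Finset α) := by
    by_contra! hcon
    have := Finset.card_le_card (fun i _ => hcon i : Finset.univ ⊆ _)
    rw [Finset.card_univ] at this
    have := this.trans Finset.card_le_three
    omega
  simp only [Finset.mem_insert, Finset.mem_singleton, not_or] at hz hw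
  have hc := swap_mul_swap_isThreeCycle (p := z) (q := σ x) (i := w) hz.2 hw.2.2 hw.2.1
  have h1 := congrArg (fun f : Perm α => f x) (h _ hc.mem_alternatingGroup)
  simp only [Perm.mul_apply] at h1
  rw [swap_apply_of_ne_of_ne (Ne.symm hx) (Ne.symm hw.1),
    swap_apply_of_ne_of_ne (Ne.symm hz.1) (Ne.symm hx), swap_apply_left,
    swap_apply_of_ne_of_ne hw.2.2 hw.2.1] at h1
  exact hw.2.1 h1.symm

theorem isOuterExtensionByTwo_perm :
    IsOuterExtensionByTwo (alternatingGroup (Fin 6)) (Perm (Fin 6)) :=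
  isOuterExtensionByTwo_of_centralizer (alternatingGroup (Fin 6)) (MulEquiv.refl _)
    alternatingGroup.index_eq_two
    fun _ h => eq_one_of_commute_alternatingGroup (by simp) h

/-- The isomorphism of the subgroup `PSL(2, 9)` of `PGL(2, 9)` with `A₆`. -/
noncomputable def equivAlternatingSix : PSL29' ≃* alternatingGroup (Fin 6) :=
  (PSL29'.equivMapOfInjective _ PGL29.toPerm_injective).trans
    ((MulEquiv.subgroupCongr map_toPerm_PSL29').trans alternatingSixEquivPSL29.symm)

theorem PGL29_eq_one_of_commute {g : PGL29} (h : ∀ k ∈ PSL29', g * k = k * g) : g = 1 := by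
  apply PGL29.toPerm_injective
  rw [map_one]
  apply eq_one_of_commute_PSL29
  intro σ hσ
  rw [← map_toPerm_PSL29'] at hσ
  obtain ⟨k, hk, rfl⟩ := hσ
  rw [← map_mul, ← map_mul, h k hk]

theorem isOuterExtensionByTwo_PGL29 :
    IsOuterExtensionByTwo (alternatingGroup (Fin 6)) PGL29 :=
  isOuterExtensionByTwo_of_centralizer PSL29' equivAlternatingSix index_PSL29'
    fun _ h => PGL29_eq_one_of_commute h

theorem frob_notMem_range_moebius (g : GL (Fin 2) F9) : moebius g ≠ frob := by
  intro h
  have hc : g ∈ Subgroup.center (GL (Fin 2) F9) := by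
    have h1 : ∀ z, frob z = z → moebius g z = z := fun z hz => by rw [h, hz]
    refine mem_center_of_moebius_fixes (h1 _ ?_) (h1 _ ?_) (h1 _ ?_)
    · rfl
    · simp [frob, OnePoint.map_some]
    · simp [frob, OnePoint.map_some]
  rw [← ker_moebius, MonoidHom.mem_ker, h] at hc
  have hω := congrArg (fun f : Perm (OnePoint F9) => f (gaussEquiv ⟨0, 1⟩ : F9)) hc
  simp only [Perm.one_apply] at hω
  have h2 : (gaussEquiv ⟨0, 1⟩) ^ 3 = gaussEquiv ⟨0, 1⟩ := OnePoint.coe_injective hω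
  rw [← map_pow] at h2
  exact absurd (gaussEquiv.injective h2) (by decide +kernel)

theorem moebius_mul_frob_notMem (g : GL (Fin 2) F9) : moebius g * frob ∉ PSL29 := by
  rintro ⟨h, -, hh⟩
  apply frob_notMem_range_moebius (g⁻¹ * h)
  rw [map_mul, hh, map_inv, inv_mul_cancel_left]

theorem PSL29_le_M10 : PSL29 ≤ M10 := by
  rintro _ ⟨g, hg, rfl⟩
  exact ⟨g, Or.inl ⟨hg, rfl⟩⟩

theorem index_PSL29_M10 : (PSL29.subgroupOf M10).index = 2 := by
  obtain ⟨u, hu⟩ := exists_not_isSquare_det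
  rw [index_eq_two_iff]
  refine ⟨⟨moebius u * frob, u, Or.inr ⟨hu, rfl⟩⟩, ?_⟩
  rintro ⟨_, g, ⟨hg, rfl⟩ | ⟨hg, rfl⟩⟩
  · refine Or.inr ⟨⟨g, hg, rfl⟩, ?_⟩
    rw [mem_subgroupOf]
    change moebius g * (moebius u * frob) ∉ _
    rw [← mul_assoc, ← map_mul]
    exact moebius_mul_frob_notMem _
  · refine Or.inl ⟨?_, moebius_mul_frob_notMem g⟩
    rw [mem_subgroupOf]
    refine ⟨g * u.map (frobenius F9 3), ?_, ?_⟩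
    · change IsSquare _
      rw [map_mul, isSquare_mul_iff, isSquare_det_frob]
      simp [hg, hu]
    · change _ = moebius g * frob * (moebius u * frob)
      rw [mul_assoc, ← mul_assoc frob, frob_moebius, mul_assoc, frob_frob, map_mul, mul_one]

/-- The isomorphism of the subgroup `PSL(2, 9)` of the Mathieu group with `A₆`. -/
noncomputable def equivAlternatingSix' : PSL29.subgroupOf M10 ≃* alternatingGroup (Fin 6) :=
  (subgroupOfEquivOfLe PSL29_le_M10).trans alternatingSixEquivPSL29.symm

theorem isOuterExtensionByTwo_M10 :
    IsOuterExtensionByTwo (alternatingGroup (Fin 6)) M10 := by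
  refine isOuterExtensionByTwo_of_centralizer _ equivAlternatingSix' index_PSL29_M10 fun g h => ?_
  apply Subtype.ext
  apply eq_one_of_commute_PSL29
  intro σ hσ
  exact congrArg Subtype.val (h ⟨σ, PSL29_le_M10 hσ⟩ hσ)

theorem isSquare_of_pow_four_eq_one {a : F9ˣ} (ha : a ^ 4 = 1) : IsSquare a := by
  have : Fintype F9 := Fintype.ofFinite _
  have h2 : ringChar F9 ≠ 2 := by
    rw [ringChar.eq F9 3]; norm_num
  rw [FiniteField.unit_isSquare_iff h2, ← Nat.card_eq_fintype_card, card_F9]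
  exact ha

/-- For an involution `moebius g * frob`, the product of `g` with its Frobenius conjugate F(g) is a
scalar s. Applying F gives s³ = s, so s² = 1. Taking determinants gives det(g)⁴ = s² = 1, so det g
is a square, a contradiction. -/
theorem M10_mul_self_ne_one {m : M10} (hm : m ∉ PSL29.subgroupOf M10) : m * m ≠ 1 := by
  obtain ⟨_, g, ⟨hg, rfl⟩ | ⟨hg, rfl⟩⟩ := m
  · exact absurd ⟨g, hg, rfl⟩ hm
  intro h
  have h1 : moebius g * frob * (moebius g * frob) = 1 := congrArg Subtype.val h
  rw [mul_assoc, ← mul_assoc frob, frob_moebius, mul_assoc, frob_frob, mul_one, ← map_mul,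
    ← MonoidHom.mem_ker, ker_moebius, Matrix.GeneralLinearGroup.center_eq_range_scalar] at h1
  obtain ⟨s, hs⟩ := h1
  apply hg
  apply isSquare_of_pow_four_eq_one
  set F := Matrix.GeneralLinearGroup.map (n := Fin 2) (frobenius F9 3) with hF
  have hFF : F (F g) = g := by
    have hpow : ∀ x : F9, (x ^ 3) ^ 3 = x := by
      intro x
      have : Fintype F9 := Fintype.ofFinite _
      have := FiniteField.pow_card x
      rw [← Nat.card_eq_fintype_card, card_F9] at this
      rw [← pow_mul]
      exact this
    ext i j
    simp [hF, frobenius_def, hpow]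
  have hcomm : F g * g = Matrix.GeneralLinearGroup.scalar (Fin 2) s := by
    have hc : g * F g ∈ Subgroup.center (GL (Fin 2) F9) := by
      rw [Matrix.GeneralLinearGroup.center_eq_range_scalar]
      exact ⟨s, hs⟩
    have := Subgroup.mem_center_iff.mp hc g
    rw [mul_assoc, mul_left_cancel_iff] at this
    rw [← this, hs]
  have hs3 : s ^ 3 = s := by
    have h1 := congrArg F hs
    rw [map_mul, hFF, hcomm] at h1
    have h2 := congrArg (fun m : GL (Fin 2) F9 => m 0 0) h1
    ext
    simpa [hF, frobenius_def] using h2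
  have hs2 : s ^ 2 = 1 := by
    have : s ^ 2 * s = 1 * s := by rw [← pow_succ, hs3, one_mul]
    exact mul_right_cancel this
  have hdet : g.det ^ 4 = s ^ 2 := by
    have h1 := congrArg Matrix.GeneralLinearGroup.det hs
    have h2 : (F g).det = g.det ^ 3 := by
      ext
      simp [hF, ← RingHom.mapMatrix_apply, ← RingHom.map_det, frobenius_def]
    rw [map_mul, h2, ← pow_succ'] at h1
    rw [← h1]
    ext
    simp
  rw [hdet, hs2]

theorem isSquare_neg_one : IsSquare (-1 : F9ˣ) :=
  isSquare_of_pow_four_eq_one (by norm_num)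

theorem exists_involution_PGL29 : ∃ t : PGL29, t ∉ PSL29' ∧ t * t = 1 := by
  obtain ⟨u, hu⟩ := exists_not_isSquare_units
  -- The map x ↦ u / x: the matrix squares to the scalar `u`, and its determinant -u is a non-square
  -- because -1 is a square.
  let g : GL (Fin 2) F9 :=
    Matrix.GeneralLinearGroup.mkOfDetNeZero !![(0 : F9), u; 1, 0] (by simp)
  have hdet : g.det = -1 * u := by
    ext
    simp [g, Matrix.GeneralLinearGroup.mkOfDetNeZero]
  refine ⟨QuotientGroup.mk' _ g, ?_, ?_⟩
  · rintro ⟨h, hh, hgh⟩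
    have : g ∈ squareDet := by
      rw [QuotientGroup.mk'_eq_mk'] at hgh
      obtain ⟨z, hz, hzg⟩ := hgh
      rw [← hzg]
      exact squareDet.mul_mem hh (center_le_squareDet hz)
    rw [mem_squareDet, hdet, isSquare_mul_iff] at this
    exact hu (this.mp isSquare_neg_one)
  · rw [← map_mul, QuotientGroup.mk'_apply, QuotientGroup.eq_one_iff,
      Matrix.GeneralLinearGroup.center_eq_range_scalar]
    refine ⟨u, ?_⟩
    ext i j
    fin_cases i <;> fin_cases j <;>
      simp [g, Matrix.GeneralLinearGroup.mkOfDetNeZero, Matrix.mul_apply]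

theorem exists_pow_eight_PGL29 : ∃ t : PGL29, t ^ 8 = 1 ∧ t ^ 4 ≠ 1 := by
  obtain ⟨z, hz⟩ := IsCyclic.exists_ofOrder_eq_natCard (α := F9ˣ)
  rw [card_units_F9] at hz
  let g : GL (Fin 2) F9 :=
    Matrix.GeneralLinearGroup.mkOfDetNeZero !![(z : F9), 0; 0, 1] (by simp)
  have hg : ∀ n, (g ^ n : GL (Fin 2) F9).val = !![(z : F9) ^ n, 0; 0, 1] := by
    intro n
    rw [Units.val_pow_eq_pow_val]
    change !![(z : F9), 0; 0, 1] ^ n = _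
    induction n with
    | zero => ext i j; fin_cases i <;> fin_cases j <;> simp
    | succ n ih => rw [pow_succ, ih]; ext i j; fin_cases i <;> fin_cases j <;> simp [pow_succ]
  refine ⟨QuotientGroup.mk' _ g, ?_, ?_⟩
  · have : g ^ 8 = 1 := by
      apply Units.ext
      rw [hg, ← Units.val_pow_eq_pow_val, ← hz, pow_orderOf_eq_one]
      ext i j; fin_cases i <;> fin_cases j <;> simp
    rw [← map_pow, this, map_one]
  · intro h
    rw [← map_pow, QuotientGroup.mk'_apply, QuotientGroup.eq_one_iff,
      Matrix.GeneralLinearGroup.mem_center_iff_val_mem_range_scalar] at h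
    obtain ⟨a, ha⟩ := h
    rw [hg] at ha
    have h0 := congrArg (fun m : Matrix (Fin 2) (Fin 2) F9 => m 0 0) ha
    have h1 := congrArg (fun m : Matrix (Fin 2) (Fin 2) F9 => m 1 1) ha
    simp at h0 h1
    rw [h1] at h0
    have h4 : z ^ 4 = 1 := by
      ext
      rw [Units.val_pow_eq_pow_val, ← h0, Units.val_one]
    have := orderOf_dvd_of_pow_eq_one h4
    rw [hz] at this
    exact absurd this (by decide)

/-- Cycle lengths divide 8 and are at most 6, so they divide 4. Hence S₆ has no element of order 8,
unlike PGL(2,9). -/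
theorem pow_four_eq_one_of_pow_eight {σ : Perm (Fin 6)} (h : σ ^ 8 = 1) : σ ^ 4 = 1 := by
  rw [← orderOf_dvd_iff_pow_eq_one, ← lcm_cycleType, Multiset.lcm_dvd] at h ⊢
  intro c hc
  have h1 := h c hc
  have h2 : c ≤ 6 := by
    have := (le_card_support_of_mem_cycleType hc).trans (Finset.card_le_univ _)
    simpa using this
  interval_cases c <;> revert h1 <;> decide

theorem isEmpty_perm_mulEquiv_PGL29 : IsEmpty (Perm (Fin 6) ≃* PGL29) := by
  refine ⟨fun f => ?_⟩
  obtain ⟨t, h8, h4⟩ := exists_pow_eight_PGL29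
  apply h4
  apply f.symm.injective
  rw [map_pow, map_one]
  apply pow_four_eq_one_of_pow_eight
  rw [← map_pow, h8, map_one]

/-- An isomorphism would send `t` to an involution of M₁₀ outside PSL(2,9), since its inverse maps
PSL(2,9) into `K`. -/
theorem isEmpty_mulEquiv_M10 {G : Type*} [Group G] {K : Subgroup G} (hK : K.index = 2) {t : G}
    (ht : t ∉ K) (htt : t * t = 1) : IsEmpty (G ≃* M10) := by
  refine ⟨fun f => M10_mul_self_ne_one (m := f t) (fun h => ht ?_) ?_⟩
  · have := apply_mem_of_index_two equivAlternatingSix' hK f.symm h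
    rwa [f.symm_apply_apply] at this
  · rw [← map_mul, htt, map_one]

theorem swap_notMem_alternatingGroup : swap (0 : Fin 6) 1 ∉ alternatingGroup (Fin 6) := by
  rw [mem_alternatingGroup]
  decide

theorem isEmpty_perm_mulEquiv_M10 : IsEmpty (Perm (Fin 6) ≃* M10) :=
  isEmpty_mulEquiv_M10 alternatingGroup.index_eq_two swap_notMem_alternatingGroup
    (swap_mul_self _ _)

theorem isEmpty_PGL29_mulEquiv_M10 : IsEmpty (PGL29 ≃* M10) := by
  obtain ⟨t, ht, htt⟩ := exists_involution_PGL29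
  exact isEmpty_mulEquiv_M10 index_PSL29' ht htt

theorem isOuterSemidirectByTwo_perm :
    IsOuterSemidirectByTwo (alternatingGroup (Fin 6)) (Perm (Fin 6)) :=
  isOuterSemidirectByTwo_of_centralizer (alternatingGroup (Fin 6)) (MulEquiv.refl _)
    alternatingGroup.index_eq_two
    (fun _ h => eq_one_of_commute_alternatingGroup (by simp) h) swap_notMem_alternatingGroup
    (swap_mul_self _ _)

theorem isOuterSemidirectByTwo_PGL29 :
    IsOuterSemidirectByTwo (alternatingGroup (Fin 6)) PGL29 := by
  obtain ⟨t, ht, htt⟩ := exists_involution_PGL29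
  exact isOuterSemidirectByTwo_of_centralizer PSL29' equivAlternatingSix index_PSL29'
    (fun g h => PGL29_eq_one_of_commute h) ht htt

end ThreeExtensions

/-! ### The four cosets of Inn(A₆) in Aut(A₆) -/

section Classification

theorem conjNormal_injective {α : Type*} [Fintype α] [DecidableEq α] (h4 : 4 ≤ Fintype.card α) :
    Function.Injective (MulAut.conjNormal : Perm α →* MulAut (alternatingGroup α)) := by
  rw [injective_iff_map_eq_one]
  intro σ hσ
  apply eq_one_of_commute_alternatingGroup h4
  intro c hc
  have := congrArg (fun f : MulAut (alternatingGroup α) => (f ⟨c, hc⟩ : Perm α)) hσ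
  simp only [MulAut.conjNormal_apply, MulAut.one_apply] at this
  rwa [mul_inv_eq_iff_eq_mul] at this

theorem map_alternatingGroup_conjNormal {α : Type*} [Fintype α] [DecidableEq α] :
    (alternatingGroup α).map (MulAut.conjNormal : Perm α →* MulAut (alternatingGroup α)) =
      innerAut (alternatingGroup α) := by
  ext x
  constructor
  · rintro ⟨k, hk, rfl⟩
    exact ⟨⟨k, hk⟩, (conjNormal_coe_eq_conj _ ⟨k, hk⟩).symm⟩
  · rintro ⟨k, rfl⟩
    exact ⟨k, k.2, conjNormal_coe_eq_conj _ k⟩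

theorem index_innerAut_le : (innerAut (alternatingGroup (Fin 6))).index ≠ 0 ∧
    (innerAut (alternatingGroup (Fin 6))).index ≤ 4 := by
  rw [← map_alternatingGroup_conjNormal, index_map]
  have h1 : (alternatingGroup (Fin 6) ⊔ (MulAut.conjNormal :
      Perm (Fin 6) →* MulAut (alternatingGroup (Fin 6))).ker).index ∣ 2 := by
    rw [← alternatingGroup.index_eq_two (α := Fin 6)]
    exact index_dvd_of_le le_sup_left
  have h2 := Nat.le_of_dvd two_pos h1
  have h3 := Nat.pos_of_dvd_of_pos h1 two_pos
  rcases index_range_conjNormal_le (α := Fin 6) (by simp) with h | h <;> rw [h] <;> omega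

theorem center_alternatingGroup_six : Subgroup.center (alternatingGroup (Fin 6)) = ⊥ :=
  alternatingGroup.center_eq_bot (by simp)

/-- Three pairwise non-isomorphic extensions exhaust the outer automorphism classes of `A₆`. -/
theorem exists_mem_coset {G₁ G₂ G₃ : Type*} [Group G₁] [Group G₂] [Group G₃]
    (h₁₂ : IsEmpty (G₁ ≃* G₂)) (h₁₃ : IsEmpty (G₁ ≃* G₃)) (h₂₃ : IsEmpty (G₂ ≃* G₃))
    {θ₁ : G₁ →* MulAut (alternatingGroup (Fin 6))} {u₁ : G₁} (h₁ : IsOuterEmbedding θ₁ u₁)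
    {θ₂ : G₂ →* MulAut (alternatingGroup (Fin 6))} {u₂ : G₂} (h₂ : IsOuterEmbedding θ₂ u₂)
    {θ₃ : G₃ →* MulAut (alternatingGroup (Fin 6))} {u₃ : G₃} (h₃ : IsOuterEmbedding θ₃ u₃)
    (φ : MulAut (alternatingGroup (Fin 6))) :
    φ ∈ innerAut (alternatingGroup (Fin 6)) ∨
      (θ₁ u₁)⁻¹ * φ ∈ innerAut (alternatingGroup (Fin 6)) ∨
      (θ₂ u₂)⁻¹ * φ ∈ innerAut (alternatingGroup (Fin 6)) ∨
      (θ₃ u₃)⁻¹ * φ ∈ innerAut (alternatingGroup (Fin 6)) := by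
  set I := innerAut (alternatingGroup (Fin 6))
  by_contra! hcon
  obtain ⟨c0, c1, c2, c3⟩ := hcon
  have h12 : (θ₁ u₁)⁻¹ * θ₂ u₂ ∉ I := fun h => h₁₂.elim (h₁.nonempty_mulEquiv h₂ h).some
  have h13 : (θ₁ u₁)⁻¹ * θ₃ u₃ ∉ I := fun h => h₁₃.elim (h₁.nonempty_mulEquiv h₃ h).some
  have h23 : (θ₂ u₂)⁻¹ * θ₃ u₃ ∉ I := fun h => h₂₃.elim (h₂.nonempty_mulEquiv h₃ h).some
  -- Otherwise there would be five distinct cosets in a quotient of at most four elements.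
  let f : Fin 5 → MulAut (alternatingGroup (Fin 6)) ⧸ I := fun i =>
    QuotientGroup.mk (![1, θ₁ u₁, θ₂ u₂, θ₃ u₃, φ] i)
  have hlt : ∀ i j, i < j → f i ≠ f j := by
    intro i j hij h
    have h := QuotientGroup.eq.mp h
    fin_cases i <;> fin_cases j <;> simp at hij h
    · exact h₁.notMem h
    · exact h₂.notMem h
    · exact h₃.notMem h
    · exact c0 (by simpa using h)
    · exact h12 (by simpa using h)
    · exact h13 (by simpa using h)
    · exact c1 (by simpa using h)
    · exact h23 (by simpa using h)
    · exact c2 (by simpa using h)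
    · exact c3 (by simpa using h)
  have hf : Function.Injective f := by
    intro i j h
    rcases lt_trichotomy i j with hij | hij | hij
    · exact absurd h (hlt i j hij)
    · exact hij
    · exact absurd h.symm (hlt j i hij)
  have hfin : Finite (MulAut (alternatingGroup (Fin 6)) ⧸ I) :=
    (Nat.finite_of_card_ne_zero index_innerAut_le.1)
  have hle := Nat.card_le_card_of_injective f hf
  have := index_innerAut_le.2
  rw [Nat.card_eq_fintype_card, Fintype.card_fin] at hle
  exact absurd (hle.trans this) (by norm_num)

/-- Each coset lies in the image of an extension in which the inner automorphisms have index two. -/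
theorem mul_self_mem_innerAut (φ : MulAut (alternatingGroup (Fin 6))) :
    φ * φ ∈ innerAut (alternatingGroup (Fin 6)) := by
  obtain ⟨θ₁, u₁, h₁⟩ :=
    isOuterExtensionByTwo_perm.exists_isOuterEmbedding center_alternatingGroup_six
  obtain ⟨θ₂, u₂, h₂⟩ :=
    isOuterExtensionByTwo_PGL29.exists_isOuterEmbedding center_alternatingGroup_six
  obtain ⟨θ₃, u₃, h₃⟩ :=
    isOuterExtensionByTwo_M10.exists_isOuterEmbedding center_alternatingGroup_six
  rcases exists_mem_coset isEmpty_perm_mulEquiv_PGL29 isEmpty_perm_mulEquiv_M10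
    isEmpty_PGL29_mulEquiv_M10 h₁ h₂ h₃ φ with h | h | h | h
  · exact mul_mem h h
  · obtain ⟨g, rfl⟩ := (h₁.mem_range_iff φ).mpr (Or.inr h)
    exact h₁.mul_self_mem g
  · obtain ⟨g, rfl⟩ := (h₂.mem_range_iff φ).mpr (Or.inr h)
    exact h₂.mul_self_mem g
  · obtain ⟨g, rfl⟩ := (h₃.mem_range_iff φ).mpr (Or.inr h)
    exact h₃.mul_self_mem g

theorem isOuterExtensionByTwo_alternatingGroup_six_iff (G : Type*) [Group G] :
    IsOuterExtensionByTwo (alternatingGroup (Fin 6)) G ↔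
      Nonempty (G ≃* Perm (Fin 6)) ∨ Nonempty (G ≃* PGL29) ∨ Nonempty (G ≃* M10) := by
  constructor
  · intro h
    obtain ⟨θ, u, hθ⟩ := h.exists_isOuterEmbedding center_alternatingGroup_six
    obtain ⟨θ₁, u₁, h₁⟩ :=
      isOuterExtensionByTwo_perm.exists_isOuterEmbedding center_alternatingGroup_six
    obtain ⟨θ₂, u₂, h₂⟩ :=
      isOuterExtensionByTwo_PGL29.exists_isOuterEmbedding center_alternatingGroup_six
    obtain ⟨θ₃, u₃, h₃⟩ :=
      isOuterExtensionByTwo_M10.exists_isOuterEmbedding center_alternatingGroup_six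
    rcases exists_mem_coset isEmpty_perm_mulEquiv_PGL29 isEmpty_perm_mulEquiv_M10
      isEmpty_PGL29_mulEquiv_M10 h₁ h₂ h₃ (θ u) with h | h | h | h
    · exact absurd h hθ.notMem
    · exact Or.inl ((h₁.nonempty_mulEquiv hθ h).map MulEquiv.symm)
    · exact Or.inr (Or.inl ((h₂.nonempty_mulEquiv hθ h).map MulEquiv.symm))
    · exact Or.inr (Or.inr ((h₃.nonempty_mulEquiv hθ h).map MulEquiv.symm))
  · rintro (⟨⟨f⟩⟩ | ⟨⟨f⟩⟩ | ⟨⟨f⟩⟩)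
    · exact isOuterExtensionByTwo_perm.of_mulEquiv f
    · exact isOuterExtensionByTwo_PGL29.of_mulEquiv f
    · exact isOuterExtensionByTwo_M10.of_mulEquiv f

end Classification

/-! ### Displacement groups of simple quandles -/

section SimpleQuandles

universe u

variable {Q : Type u} [Quandle Q]

theorem act'_mem_LMlt (x : Q) : Rack.act' x ∈ LMlt Q := subset_closure ⟨x, rfl⟩

theorem act'_mul_inv_mem_Dis (x y : Q) : Rack.act' x * (Rack.act' y)⁻¹ ∈ Dis Q :=
  subset_closure ⟨x, y, rfl⟩

theorem Dis_le_LMlt : Dis Q ≤ LMlt Q := by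
  rw [Dis, closure_le]
  rintro _ ⟨x, y, rfl⟩
  exact mul_mem (act'_mem_LMlt x) (inv_mem (act'_mem_LMlt y))

/-- Elements of the left multiplication group are automorphisms. -/
theorem conj_act' {g : Perm Q} (hg : g ∈ LMlt Q) (x : Q) :
    g * Rack.act' x * g⁻¹ = Rack.act' (g x) := by
  induction hg using closure_induction generalizing x with
  | mem g hg =>
    obtain ⟨y, rfl⟩ := hg
    exact (Rack.ad_conj y x).symm
  | one => simp
  | mul g h _ _ ihg ihh =>
    rw [Perm.mul_apply, ← ihg, ← ihh]
    group
  | inv g _ ih =>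
    have := ih (g⁻¹ x)
    rw [show g (g⁻¹ x) = x from g.apply_symm_apply x] at this
    rw [← this]
    group

theorem conj_mem_Dis {g : Perm Q} (hg : g ∈ LMlt Q) {d : Perm Q} (hd : d ∈ Dis Q) :
    g * d * g⁻¹ ∈ Dis Q := by
  induction hd using closure_induction with
  | mem d hd =>
    obtain ⟨x, y, rfl⟩ := hd
    have : g * (Rack.act' x * (Rack.act' y)⁻¹) * g⁻¹ =
        (g * Rack.act' x * g⁻¹) * (g * Rack.act' y * g⁻¹)⁻¹ := by group
    rw [this, conj_act' hg, conj_act' hg]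
    exact act'_mul_inv_mem_Dis _ _
  | one => simp [one_mem]
  | mul a b _ _ iha ihb =>
    rw [show g * (a * b) * g⁻¹ = (g * a * g⁻¹) * (g * b * g⁻¹) by group]
    exact mul_mem iha ihb
  | inv a _ ih =>
    rw [show g * a⁻¹ * g⁻¹ = (g * a * g⁻¹)⁻¹ by group]
    exact inv_mem ih

theorem conj_mem_Dis' {g : Perm Q} (hg : g ∈ LMlt Q) {d : Perm Q} (hd : d ∈ Dis Q) :
    g⁻¹ * d * g ∈ Dis Q := by
  simpa using conj_mem_Dis (inv_mem hg) hd

/-- Conjugating a translation by `g` gives another translation, so the commutator of `g` with a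
translation is a displacement; commutator identities extend this to all `h`. -/
theorem commutator_mem_Dis {g h : Perm Q} (hg : g ∈ LMlt Q) (hh : h ∈ LMlt Q) :
    g * h * g⁻¹ * h⁻¹ ∈ Dis Q := by
  induction hh using closure_induction with
  | mem h hh =>
    obtain ⟨y, rfl⟩ := hh
    rw [conj_act' hg]
    exact act'_mul_inv_mem_Dis _ _
  | one => simp [one_mem]
  | mul a b ha _ iha ihb =>
    rw [show g * (a * b) * g⁻¹ * (a * b)⁻¹ =
      (g * a * g⁻¹ * a⁻¹) * (a * (g * b * g⁻¹ * b⁻¹) * a⁻¹) by group]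
    exact mul_mem iha (conj_mem_Dis ha ihb)
  | inv a ha ih =>
    rw [show g * a⁻¹ * g⁻¹ * a⁻¹⁻¹ = a⁻¹ * (g * a * g⁻¹ * a⁻¹)⁻¹ * a by group]
    exact conj_mem_Dis' ha (inv_mem ih)

/-- If the square of some translation is a displacement, then the displacement group has index at
most two. -/
theorem mem_Dis_or_mul_act'_mem_Dis {x : Q} (hx : Rack.act' x * Rack.act' x ∈ Dis Q) {g : Perm Q}
    (hg : g ∈ LMlt Q) : g ∈ Dis Q ∨ g * Rack.act' x ∈ Dis Q := by
  have hL := act'_mem_LMlt x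
  induction hg using closure_induction with
  | mem g hg =>
    obtain ⟨y, rfl⟩ := hg
    right
    have := mul_mem (act'_mul_inv_mem_Dis y x) hx
    simpa [mul_assoc] using this
  | one => exact Or.inl (one_mem _)
  | mul a b ha hb iha ihb =>
    rcases iha with iha | iha <;> rcases ihb with ihb | ihb
    · exact Or.inl (mul_mem iha ihb)
    · right
      rw [mul_assoc]
      exact mul_mem iha ihb
    · right
      rw [show a * b * Rack.act' x =
        (a * Rack.act' x) * ((Rack.act' x)⁻¹ * b * Rack.act' x) by group]
      exact mul_mem iha (conj_mem_Dis' hL ihb)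
    · left
      rw [show a * b = (a * Rack.act' x) * ((Rack.act' x)⁻¹ * (b * Rack.act' x) * Rack.act' x) *
        (Rack.act' x * Rack.act' x)⁻¹ by group]
      exact mul_mem (mul_mem iha (conj_mem_Dis' hL ihb)) (inv_mem hx)
  | inv a ha ih =>
    rcases ih with ih | ih
    · exact Or.inl (inv_mem ih)
    · right
      rw [show a⁻¹ * Rack.act' x = (Rack.act' x * (a * Rack.act' x)⁻¹ * (Rack.act' x)⁻¹) *
        (Rack.act' x * Rack.act' x) by group]
      exact mul_mem (conj_mem_Dis hL (inv_mem ih)) hx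

/-- The quandle of orbits of a normal subgroup of the left multiplication group. -/
@[reducible] def orbitQuandle (N : Subgroup (Perm Q)) (hN : N ≤ LMlt Q)
    (hconj : ∀ g ∈ LMlt Q, ∀ n ∈ N, g * n * g⁻¹ ∈ N) :
    Quandle (MulAction.orbitRel.Quotient N Q) where
  act := Quotient.map₂ (fun x y => x ◃ y) (by
    rintro _ a ⟨⟨n, hn⟩, rfl⟩ _ x ⟨⟨m, hm⟩, rfl⟩
    -- The witness comes from L_{n a} m = n L_a n⁻¹ m = (n · L_a n⁻¹ m L_a⁻¹) L_a, whose bracket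
    -- lies in `N` by normality.
    refine ⟨⟨n * (Rack.act' a * (n⁻¹ * m) * (Rack.act' a)⁻¹),
      mul_mem hn (hconj _ (act'_mem_LMlt a) _ (mul_mem (inv_mem hn) hm))⟩, ?_⟩
    change _ = Rack.act' (n a) (m x)
    rw [← conj_act' (hN hn)]
    change (n * (Rack.act' a * (n⁻¹ * m) * (Rack.act' a)⁻¹) * Rack.act' a) x =
      (n * Rack.act' a * n⁻¹ * m) x
    congr 1
    group)
  self_distrib := by
    rintro ⟨x⟩ ⟨y⟩ ⟨z⟩
    exact congrArg (Quotient.mk _) Shelf.self_distrib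
  invAct := Quotient.map₂ (fun x y => x ◃⁻¹ y) (by
    rintro _ a ⟨⟨n, hn⟩, rfl⟩ _ x ⟨⟨m, hm⟩, rfl⟩
    have hc := hconj _ (inv_mem (act'_mem_LMlt a)) _ (mul_mem (inv_mem hn) hm)
    refine ⟨⟨n * ((Rack.act' a)⁻¹ * (n⁻¹ * m) * (Rack.act' a)⁻¹⁻¹), mul_mem hn hc⟩, ?_⟩
    change _ = (Rack.act' (n a))⁻¹ (m x)
    rw [← conj_act' (hN hn)]
    change (n * ((Rack.act' a)⁻¹ * (n⁻¹ * m) * (Rack.act' a)⁻¹⁻¹) * (Rack.act' a)⁻¹) x =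
      ((n * Rack.act' a * n⁻¹)⁻¹ * m) x
    congr 1
    group)
  left_inv := by
    rintro ⟨x⟩ ⟨y⟩
    exact congrArg (Quotient.mk _) (Rack.left_inv x y)
  right_inv := by
    rintro ⟨x⟩ ⟨y⟩
    exact congrArg (Quotient.mk _) (Rack.right_inv x y)
  fix := by
    rintro ⟨x⟩
    exact congrArg (Quotient.mk _) Quandle.fix

/-- The projection to the orbit quandle is injective when all orbits are points and constant when
there is only one orbit. -/
theorem IsSimpleQuandle.eq_bot_or_transitive (hQ : IsSimpleQuandle Q) (N : Subgroup (Perm Q))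
    (hN : N ≤ LMlt Q) (hconj : ∀ g ∈ LMlt Q, ∀ n ∈ N, g * n * g⁻¹ ∈ N) :
    N = ⊥ ∨ ∀ x y, ∃ n ∈ N, n x = y := by
  let _ := orbitQuandle N hN hconj
  let f : Q →◃ MulAction.orbitRel.Quotient N Q :=
    { toFun := fun x => Quotient.mk _ x
      map_act' := fun {_ _} => rfl }
  have hf : ∀ x y, f x = f y ↔ ∃ n ∈ N, n y = x := by
    intro x y
    change Quotient.mk _ x = Quotient.mk _ y ↔ _
    rw [Quotient.eq]
    constructor
    · rintro ⟨⟨n, hn⟩, rfl⟩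
      exact ⟨n, hn, rfl⟩
    · rintro ⟨n, hn, rfl⟩
      exact ⟨⟨n, hn⟩, rfl⟩
  rcases hQ.injective_or_constant _ f with h | ⟨c, hc⟩
  · left
    rw [eq_bot_iff]
    intro n hn
    rw [Subgroup.mem_bot]
    ext x
    exact h ((hf (n x) x).mpr ⟨n, hn, rfl⟩)
  · right
    intro x y
    exact (hf y x).mp ((hc y).trans (hc x).symm)

/-- In a simple quandle with centerless non-trivial displacement group, only the identity
centralizes the displacement group. -/
theorem IsSimpleQuandle.eq_one_of_commute_Dis (hQ : IsSimpleQuandle Q)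
    (hcenter : ∀ z ∈ Dis Q, (∀ d ∈ Dis Q, z * d = d * z) → z = 1) (hne : Dis Q ≠ ⊥) {g : Perm Q}
    (hg : g ∈ LMlt Q) (hcomm : ∀ d ∈ Dis Q, g * d = d * g) : g = 1 := by
  let N : Subgroup (Perm Q) := LMlt Q ⊓ centralizer (Dis Q)
  have hNmem : ∀ n, n ∈ N ↔ n ∈ LMlt Q ∧ ∀ d ∈ Dis Q, n * d = d * n := by
    intro n
    rw [mem_inf, mem_centralizer_iff]
    exact and_congr_right fun _ => forall₂_congr fun d _ => eq_comm
  have hconj : ∀ g ∈ LMlt Q, ∀ n ∈ N, g * n * g⁻¹ ∈ N := by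
    intro g hg n hn
    rw [hNmem] at hn ⊢
    refine ⟨mul_mem (mul_mem hg hn.1) (inv_mem hg), fun d hd => ?_⟩
    calc g * n * g⁻¹ * d = g * (n * (g⁻¹ * d * g)) * g⁻¹ := by group
      _ = g * ((g⁻¹ * d * g) * n) * g⁻¹ := by rw [hn.2 _ (conj_mem_Dis' hg hd)]
      _ = d * (g * n * g⁻¹) := by group
  have habel : ∀ a ∈ N, ∀ b ∈ N, a * b = b * a := by
    intro a ha b hb
    have h1 : a * b * a⁻¹ * b⁻¹ = 1 := by
      apply hcenter _ (commutator_mem_Dis ((hNmem a).mp ha).1 ((hNmem b).mp hb).1)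
      exact ((hNmem _).mp (mul_mem (mul_mem (mul_mem ha hb) (inv_mem ha)) (inv_mem hb))).2
    rwa [mul_inv_eq_one, mul_inv_eq_iff_eq_mul] at h1
  have hgN : g ∈ N := (hNmem g).mpr ⟨hg, hcomm⟩
  rcases hQ.eq_bot_or_transitive N inf_le_left hconj with h | h
  · rwa [h, Subgroup.mem_bot] at hgN
  · exfalso
    apply hne
    obtain ⟨x, -⟩ := hQ.nontrivial
    -- An element commuting with a transitive abelian group belongs to it: `d` agrees with some `c`
    -- in `N` at `x`, and both commute with the elements of `N` that carry `x` everywhere.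
    have hDN : Dis Q ≤ N := by
      intro d hd
      obtain ⟨c, hc, hcx⟩ := h x (d x)
      have : d = c := by
        ext y
        obtain ⟨b, hb, rfl⟩ := h x y
        have h1 := congrArg (fun f : Perm Q => f x) (((hNmem b).mp hb).2 d hd)
        have h2 := congrArg (fun f : Perm Q => f x) (habel b hb c hc)
        simp only [Perm.mul_apply] at h1 h2
        rw [← h1, ← h2, hcx]
      rwa [this]
    rw [eq_bot_iff]
    intro d hd
    rw [Subgroup.mem_bot]
    exact hcenter d hd ((hNmem d).mp (hDN hd)).2

/-- The action by conjugation of the left multiplication group on the displacement group. -/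
theorem IsSimpleQuandle.exists_embedding (hQ : IsSimpleQuandle Q) {n : ℕ} (hn : 5 ≤ n)
    (e : Dis Q ≃* alternatingGroup (Fin n)) :
    ∃ (D : Subgroup (LMlt Q)) (eD : D ≃* alternatingGroup (Fin n))
      (θ : LMlt Q →* MulAut (alternatingGroup (Fin n))),
      (∀ g : LMlt Q, g ∈ D ↔ (g : Perm Q) ∈ Dis Q) ∧
      (∀ g : LMlt Q, (∀ k ∈ D, g * k = k * g) → g = 1) ∧
      Function.Injective θ ∧ ∀ d : D, θ d = MulAut.conj (eD d) := by
  have hcenterA := alternatingGroup.center_eq_bot (α := Fin n) (by simp; omega)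
  have hcenter : ∀ z ∈ Dis Q, (∀ d ∈ Dis Q, z * d = d * z) → z = 1 := by
    intro z hz h
    have : e ⟨z, hz⟩ ∈ Subgroup.center (alternatingGroup (Fin n)) := by
      rw [Subgroup.mem_center_iff]
      intro a
      obtain ⟨d, rfl⟩ := e.surjective a
      rw [← map_mul, ← map_mul]
      congr 1
      exact Subtype.ext (h d d.2).symm
    rw [hcenterA, Subgroup.mem_bot, map_eq_one_iff e e.injective] at this
    exact congrArg Subtype.val this
  have hne : Dis Q ≠ ⊥ := by
    intro h
    have hnt : Nontrivial (alternatingGroup (Fin n)) :=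
      alternatingGroup.nontrivial_of_three_le_card (by simp; omega)
    obtain ⟨a, ha⟩ := exists_ne (1 : alternatingGroup (Fin n))
    apply ha
    apply e.symm.injective
    rw [map_one]
    apply Subtype.ext
    exact (Subgroup.mem_bot).mp (h.le (e.symm a).2)
  let D : Subgroup (LMlt Q) := (Dis Q).subgroupOf (LMlt Q)
  have hDn : D.Normal := ⟨fun d hd g => conj_mem_Dis g.2 hd⟩
  let eD : D ≃* alternatingGroup (Fin n) := (subgroupOfEquivOfLe Dis_le_LMlt).trans e
  have hcent : ∀ g : LMlt Q, (∀ k ∈ D, g * k = k * g) → g = 1 := by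
    intro g hg
    apply Subtype.ext
    apply hQ.eq_one_of_commute_Dis hcenter hne g.2
    intro d hd
    exact congrArg Subtype.val (hg ⟨d, Dis_le_LMlt hd⟩ hd)
  refine ⟨D, eD, (MulAut.congr eD).toMonoidHom.comp MulAut.conjNormal, fun g => Iff.rfl, hcent,
    ?_, fun d => ?_⟩
  · rw [injective_iff_map_eq_one]
    intro g hg
    apply hcent
    intro k hk
    have hg1 : (MulAut.conjNormal g : MulAut D) = 1 := (MulAut.congr eD).injective (by
      rw [map_one]; exact hg)
    have := congrArg (fun f : MulAut D => (f ⟨k, hk⟩ : LMlt Q)) hg1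
    simp only [MulAut.conjNormal_apply, MulAut.one_apply] at this
    rwa [mul_inv_eq_iff_eq_mul] at this
  · change MulAut.congr eD (MulAut.conjNormal (d : LMlt Q)) = _
    rw [conjNormal_coe_eq_conj]
    ext x
    simp [MulAut.congr]

theorem IsSimpleQuandle.LMlt_of_ne_six (hQ : IsSimpleQuandle Q) {n : ℕ} (hn : 5 ≤ n) (h6 : n ≠ 6)
    (e : Dis Q ≃* alternatingGroup (Fin n)) :
    Nonempty (LMlt Q ≃* alternatingGroup (Fin n)) ∨ Nonempty (LMlt Q ≃* Perm (Fin n)) := by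
  obtain ⟨D, eD, θ, -, -, hθ, hD⟩ := hQ.exists_embedding hn e
  let f : Perm (Fin n) ≃* MulAut (alternatingGroup (Fin n)) :=
    MulEquiv.ofBijective MulAut.conjNormal ⟨conjNormal_injective (by simp; omega),
      MonoidHom.range_eq_top.mp (range_conjNormal_eq_top (by simpa) (by simpa))⟩
  let ψ : LMlt Q →* Perm (Fin n) := f.symm.toMonoidHom.comp θ
  have hψ : Function.Injective ψ := f.symm.injective.comp hθ
  have hle : alternatingGroup (Fin n) ≤ ψ.range := by
    intro a ha
    refine ⟨eD.symm ⟨a, ha⟩, ?_⟩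
    change f.symm (θ _) = a
    rw [hD, eD.apply_symm_apply, MulEquiv.symm_apply_eq]
    exact (conjNormal_coe_eq_conj _ ⟨a, ha⟩).symm
  have hnt : Nontrivial (Fin n) := Fin.nontrivial_iff_two_le.mpr (by omega)
  have hdvd := index_dvd_of_le hle
  rw [alternatingGroup.index_eq_two, Nat.dvd_prime Nat.prime_two] at hdvd
  rcases hdvd with h | h
  · right
    exact ⟨(MonoidHom.ofInjective hψ).trans
      ((MulEquiv.subgroupCongr (index_eq_one.mp h)).trans topEquiv)⟩
  · left
    exact ⟨(MonoidHom.ofInjective hψ).trans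
      (MulEquiv.subgroupCongr (eq_alternatingGroup_of_index_eq_two h))⟩

theorem IsSimpleQuandle.LMlt_of_six (hQ : IsSimpleQuandle Q)
    (e : Dis Q ≃* alternatingGroup (Fin 6)) :
    Nonempty (LMlt Q ≃* alternatingGroup (Fin 6)) ∨
      IsOuterExtensionByTwo (alternatingGroup (Fin 6)) (LMlt Q) := by
  obtain ⟨D, eD, θ, hmem, hcent, hθ, hD⟩ := hQ.exists_embedding (by norm_num) e
  have hsq : ∀ g : LMlt Q, g * g ∈ D := by
    intro g
    obtain ⟨a, ha⟩ := mul_self_mem_innerAut (θ g)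
    have : θ (g * g) = θ (eD.symm a) := by rw [map_mul, hD, eD.apply_symm_apply, ← ha]
    rw [hθ this]
    exact (eD.symm a).2
  obtain ⟨x, -⟩ := hQ.nontrivial
  let t : LMlt Q := ⟨Rack.act' x, act'_mem_LMlt x⟩
  -- All translations are congruent modulo `Dis Q`, so one translation with square in `Dis Q` bounds
  -- the index by two.
  have hor : ∀ g : LMlt Q, g ∈ D ∨ g * t ∈ D := by
    intro g
    rw [hmem, hmem]
    exact mem_Dis_or_mul_act'_mem_Dis ((hmem _).mp (hsq t)) g.2
  by_cases ht : t ∈ D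
  · left
    have htop : D = ⊤ := by
      rw [eq_top_iff]
      intro g _
      exact (hor g).elim id fun h => (D.mul_mem_cancel_right ht).mp h
    exact ⟨(topEquiv.symm.trans (MulEquiv.subgroupCongr htop.symm)).trans eD⟩
  · right
    refine isOuterExtensionByTwo_of_centralizer D eD (index_eq_two_iff.mpr ⟨t, fun g => ?_⟩) hcent
    rcases hor g with h | h
    · exact Or.inr ⟨h, fun h' => ht ((D.mul_mem_cancel_left h).mp h')⟩
    · exact Or.inl ⟨h, fun h' => ht ((D.mul_mem_cancel_left h').mp h)⟩

end SimpleQuandles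

end

theorem lemmal :
    (∀ (Q : Type*) [Quandle Q] (n : ℕ), IsSimpleQuandle Q → 5 ≤ n →
      Nonempty (Dis Q ≃* alternatingGroup (Fin n)) →
        (n ≠ 6 → Nonempty (LMlt Q ≃* alternatingGroup (Fin n)) ∨
          Nonempty (LMlt Q ≃* Equiv.Perm (Fin n))) ∧
        (n = 6 → Nonempty (LMlt Q ≃* alternatingGroup (Fin 6)) ∨
          Nonempty (LMlt Q ≃* Equiv.Perm (Fin 6)) ∨
          Nonempty (LMlt Q ≃* PGL29) ∨
          Nonempty (LMlt Q ≃* M10))) ∧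
    (∀ (G : Type*) [Group G], IsOuterExtensionByTwo (alternatingGroup (Fin 6)) G ↔
      Nonempty (G ≃* Equiv.Perm (Fin 6)) ∨ Nonempty (G ≃* PGL29) ∨ Nonempty (G ≃* M10)) ∧
    IsEmpty (Equiv.Perm (Fin 6) ≃* PGL29) ∧
    IsEmpty (Equiv.Perm (Fin 6) ≃* M10) ∧
    IsEmpty (PGL29 ≃* M10) ∧
    IsOuterSemidirectByTwo (alternatingGroup (Fin 6)) (Equiv.Perm (Fin 6)) ∧
    IsOuterSemidirectByTwo (alternatingGroup (Fin 6)) PGL29 := by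
  refine ⟨fun Q _ n hQ hn ⟨e⟩ => ⟨fun h6 => hQ.LMlt_of_ne_six hn h6 e, fun h6 => ?_⟩,
    fun G _ => isOuterExtensionByTwo_alternatingGroup_six_iff G, isEmpty_perm_mulEquiv_PGL29,
    isEmpty_perm_mulEquiv_M10, isEmpty_PGL29_mulEquiv_M10, isOuterSemidirectByTwo_perm,
    isOuterSemidirectByTwo_PGL29⟩
  subst h6
  exact (hQ.LMlt_of_six e).imp_right
    (isOuterExtensionByTwo_alternatingGroup_six_iff (LMlt Q)).mp
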